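/- **Setting.** Let $k\ge 1$, ${\bf n}=(n_1,\dots,n_k)$ and ${\bf m}=(m_1,\dots,m_k)$ with $n_i,m_i\in\{1,2,\dots\}$. Let $\mathbb F_{n_i}^+$ be the free monoid on $g^i_1,\dots,g^i_{n_i}$, with identity $g^i_0$, and let ${\bf f}=(f_1,\dots,f_k)$, where $f_i=\sum_{\alpha\in\mathbb F_{n_i}^+}a_{i,\alpha}Z_\alpha$ is a positive regular free holomorphic function: $a_{i,\alpha}\ge 0$, $a_{i,g_0^i}=0$, $a_{i,g_j^i}>0$ for all $j$, and $\limsup_{p\to\infty}\big(\sum_{|\alpha|=p}|a_{i,\alpha}|^2\big)^{1/2p}<\infty$. For a complex Hilbert space $\mathcal H$ and $X_i\in B(\mathcal H)^{n_i}$ put $\Phi_{f_i,X_i}(Y)=\sum_\alpha a_{i,\alpha}X_{i,\alpha}YX_{i,\alpha}^*$ (weak operator topology) and ${\bf \Delta}^{\bf p}_{\bf f,X}=(id-\Phi_{f_1,X_1})^{p_1}\cdots(id-\Phi_{f_k,X_k})^{p_k}$. The polydomain ${\bf D_f^m}(\mathcal H)$ is the set of all ${\bf X}=(X_1,\dots,X_k)$,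 $X_i=(X_{i,1},\dots,X_{i,n_i})\in B(\mathcal H)^{n_i}$, such that the entries of $X_p$ commute with those of $X_q$ for $p\ne q$, each series $\Phi_{f_i,X_i}(I)$ converges with $\Phi_{f_i,X_i}(I)\le I$, and ${\bf \Delta}_{\bf f,X}^{(\epsilon_1m_1,\dots,\epsilon_km_k)}(I)\ge 0$ for all $\epsilon_i\in\{0,1\}$. Such an ${\bf X}$ is *pure* if $\lim_{{\bf q}\in\mathbb Z_+^k}(id-\Phi_{f_k,X_k}^{q_k})\cdots(id-\Phi_{f_1,X_1}^{q_1})(I)=I$, and *completely non-coisometric* if there is no $h\ne 0$ with $\langle(id-\Phi_{f_1,X_1}^{q_1})\cdots(id-\Phi_{f_k,X_k}^{q_k})(I)h,h\rangle=0$ for all $q_1,\dots,q_k\ge 1$. Let $b_{i,g_0^i}=1$ and $b_{i,\alpha}=\sum_{p=1}^{|\alpha|}\sum_{\gamma_1\cdots\gamma_p=\alpha,\ |\gamma_s|\ge1}a_{i,\gamma_1}\cdots a_{i,\gamma_p}\binom{p+m_i-1}{m_i-1}$ for $|\alpha|\ge 1$. Let $F^2=F^2(H_{n_1})\otimes\cdots\otimes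 F^2(H_{n_k})$ be the tensor product of full Fock spaces with orthonormal basis $e^1_{\beta_1}\otimes\cdots\otimes e^k_{\beta_k}$, $\beta_i\in\mathbb F_{n_i}^+$, and let ${\bf W}_{i,j}$ act on the $i$-th factor by $e^i_\alpha\mapsto\sqrt{b_{i,\alpha}}/\sqrt{b_{i,g_j\alpha}}\;e^i_{g_j\alpha}$ and trivially on the others. An operator $M:F^2\otimes\mathcal E\to F^2\otimes\mathcal G$ is *multi-analytic* if $M({\bf W}_{i,j}\otimes I)=({\bf W}_{i,j}\otimes I)M$ for all $i,j$, and *inner* if it is moreover a partial isometry. For ${\bf X}\in{\bf D_f^m}(\mathcal H)$ put $\mathcal D_{\bf X}=\overline{{\bf\Delta_{f,X}^m}(I)\mathcal H}$; the Berezin kernel ${\bf K_{f,X}}:\mathcal H\to F^2\otimes\mathcal D_{\bf X}$ is $${\bf K_{f,X}}h=\sum_{\beta_1,\dots,\beta_k}\sqrt{b_{1,\beta_1}}\cdots\sqrt{b_{k,\beta_k}}\;e^1_{\beta_1}\otimes\cdots\otimes e^k_{\beta_k}\otimes{\bf\Delta_{f,X}^m}(I)^{1/2}X_{1,\beta_1}^*\cdots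 X_{k,\beta_k}^*h.$$ Let $\mathcal C_{\bf f}^{\bf m}(\mathcal H)$ be the set of all ${\bf T}\in{\bf D_f^m}(\mathcal H)$ for which there are a Hilbert space $\mathcal E$ and a multi-analytic operator $\Psi:F^2\otimes\mathcal E\to F^2\otimes\mathcal D_{\bf T}$ with ${\bf K_{f,T}}{\bf K_{f,T}^*}+\Psi\Psi^*=I$. For such ${\bf T}$ let $Y=I-{\bf K_{f,T}}{\bf K_{f,T}^*}$ and $\mathcal M_{\bf T}=\overline{{\rm range}\,Y}$, let $A_{i,j}\in B(\mathcal M_{\bf T})$ be the operator determined by $A_{i,j}Y^{1/2}x=Y^{1/2}({\bf W}_{i,j}^*\otimes I)x$ for all $x\in F^2\otimes\mathcal D_{\bf T}$, and let ${\bf M_T}=(A_{i,j}^*)$. The characteristic function of ${\bf T}$ is $\Theta_{\bf f,T}=Y^{1/2}\,{\bf K}_{{\bf f},{\bf M_T}}^*:F^2\otimes\mathcal D_{{\bf M_T}}\to F^2\otimes\mathcal D_{\bf T}$. **Theorem.** Let ${\bf T}\in\mathcal C_{\bf f}^{\bf m}(\mathcal H)$. Then the operators used to define $\Theta_{\bf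 f,T}$ (that is, the bounded operators ${\bf K_{f,T}}$, $A_{i,j}$ and ${\bf K}_{{\bf f},{\bf M_T}}$) exist, and: 1. If ${\bf T}$ is completely non-coisometric, then ${\bf T}$ is pure if and only if $\Theta_{\bf f,T}$ is an inner multi-analytic operator. 2. If ${\bf T}$ is pure (whether or not it is assumed completely non-coisometric), then $\Theta_{\bf f,T}$ is an inner multi-analytic operator, and ${\bf T}$ is unitarily equivalent to ${\bf G}=(G_{i,j})$, $G_{i,j}=P_{\bf H_{f,T}}({\bf W}_{i,j}\otimes I)|_{\bf H_{f,T}}$, where ${\bf H_{f,T}}=(F^2\otimes\mathcal D_{\bf T})\ominus{\rm range}\,\Theta_{\bf f,T}$; that is, $T_{i,j}=U^*G_{i,j}U$ for all $i,j$, for some unitary $U:\mathcal H\to{\bf H_{f,T}}$. -/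

import Mathlib

open scoped ENNReal InnerProduct

noncomputable section

namespace Polydomain

universe u v

/-! ### Positive regular free holomorphic functions and their weights -/

/-- A positive regular free holomorphic function `f = ∑ a_α Z_α` in `n` noncommuting
indeterminates, given by its coefficients, indexed by the words of the free monoid. -/
structure PosRegular (n : ℕ) where
  coeff : FreeMonoid (Fin n) → ℝ
  coeff_nonneg : ∀ α, 0 ≤ coeff α
  coeff_one : coeff 1 = 0
  coeff_of_pos : ∀ j, 0 < coeff (FreeMonoid.of j)
  /-- `limsup_p (∑_{|α| = p} |a_α|²)^{1/(2p)} < ∞`. -/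
  limsup_lt_top :
    Filter.limsup (fun p : ℕ =>
      ENNReal.ofReal ((∑ w : Fin p → Fin n,
        |coeff (FreeMonoid.ofList (List.ofFn w))| ^ 2) ^ (1 / (2 * (p : ℝ))))) Filter.atTop < ⊤

/-- The weight `b_α^{(m)} = ∑_p ∑_{γ₁⋯γ_p = α, |γ_s| ≥ 1} a_{γ₁}⋯a_{γ_p} (p+m-1 choose m-1)`.
The factorizations of `α` into nonempty words are its splittings along the compositions of `|α|`;
the empty word has exactly one (empty) factorization, so that its weight is `1`. -/
def weight {n : ℕ} (f : PosRegular n) (m : ℕ) (α : FreeMonoid (Fin n)) : ℝ :=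
  ∑ c : Composition (FreeMonoid.toList α).length,
    (((FreeMonoid.toList α).splitWrtComposition c).map
        fun γ => f.coeff (FreeMonoid.ofList γ)).prod *
      ((c.length + m - 1).choose (m - 1) : ℝ)

theorem weight_one {n : ℕ} (f : PosRegular n) (m : ℕ) : weight f m 1 = 1 := by
  have key : ∀ l : List (Fin n), l.length = 0 →
      ∑ c : Composition l.length,
        ((l.splitWrtComposition c).map fun γ => f.coeff (FreeMonoid.ofList γ)).prod *
        ((c.length + m - 1).choose (m - 1) : ℝ) = 1 := by
    intro l hl
    obtain rfl := List.length_eq_zero_iff.mp hl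
    have h0 : ∀ c : Composition ([] : List (Fin n)).length, c.blocks = [] := fun c => by
      have := c.blocks_sum
      rcases hb : c.blocks with _ | ⟨a, t⟩
      · rfl
      · have hp := c.blocks_pos (i := a) (by simp [hb])
        rw [hb] at this
        simp at this
        omega
    have hsub : Subsingleton (Composition ([] : List (Fin n)).length) :=
      ⟨fun c d => Composition.ext ((h0 c).trans (h0 d).symm)⟩
    rw [Fintype.sum_subsingleton _ (default : Composition ([] : List (Fin n)).length)]
    simp [List.splitWrtComposition, List.splitWrtCompositionAux, Composition.length, h0]
  exact key _ rfl

theorem weight_nonneg {n : ℕ} (f : PosRegular n) (m : ℕ) (α : FreeMonoid (Fin n)) :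
    0 ≤ weight f m α := by
  refine Finset.sum_nonneg fun c _ => mul_nonneg (List.prod_nonneg ?_) (by positivity)
  intro a ha
  obtain ⟨γ, _, rfl⟩ := List.mem_map.mp ha
  exact f.coeff_nonneg _

/-- `a_{g_j} b_α ≤ b_{g_j α}`: the weighted creation operators are bounded. -/
theorem coeff_mul_weight_le {n : ℕ} (f : PosRegular n) (m : ℕ) (j : Fin n)
    (α : FreeMonoid (Fin n)) :
    f.coeff (FreeMonoid.of j) * weight f m α ≤ weight f m (FreeMonoid.of j * α) := by
  have key : ∀ l : List (Fin n),
      f.coeff (FreeMonoid.of j) * (∑ c : Composition l.length,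
        ((l.splitWrtComposition c).map fun γ => f.coeff (FreeMonoid.ofList γ)).prod *
        ((c.length + m - 1).choose (m - 1) : ℝ)) ≤
      ∑ c : Composition (j :: l).length,
        (((j :: l).splitWrtComposition c).map fun γ => f.coeff (FreeMonoid.ofList γ)).prod *
        ((c.length + m - 1).choose (m - 1) : ℝ) := by
    intro l
    let e : Composition l.length → Composition (j :: l).length := fun c =>
      ⟨1 :: c.blocks, by
        intro i hi
        rcases List.mem_cons.mp hi with rfl | h
        · exact Nat.one_pos
        · exact c.blocks_pos h, by simp [c.blocks_sum, add_comm]⟩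
    have he : Function.Injective e := fun c d h => by
      have h' := congrArg Composition.blocks h
      exact Composition.ext (List.cons.inj h').2
    have hnn : ∀ c : Composition (j :: l).length,
        0 ≤ (((j :: l).splitWrtComposition c).map
          fun γ => f.coeff (FreeMonoid.ofList γ)).prod *
          ((c.length + m - 1).choose (m - 1) : ℝ) := fun c => by
      refine mul_nonneg (List.prod_nonneg ?_) (by positivity)
      intro a ha
      obtain ⟨γ, _, rfl⟩ := List.mem_map.mp ha
      exact f.coeff_nonneg _
    rw [Finset.mul_sum]
    calc _ ≤ ∑ c : Composition l.length,
          (((j :: l).splitWrtComposition (e c)).map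
            fun γ => f.coeff (FreeMonoid.ofList γ)).prod *
          (((e c).length + m - 1).choose (m - 1) : ℝ) := by
            refine Finset.sum_le_sum fun c _ => ?_
            have h1 : (j :: l).splitWrtComposition (e c) =
                [j] :: l.splitWrtComposition c := by
              simp [e, List.splitWrtComposition, List.splitWrtCompositionAux_cons]
            have h2 : (e c).length = c.length + 1 := by simp [e, Composition.length]
            rw [h1, h2, List.map_cons, List.prod_cons, ← mul_assoc]
            refine mul_le_mul_of_nonneg_left ?_ (mul_nonneg (f.coeff_nonneg _)
              (List.prod_nonneg ?_))
            · exact_mod_cast Nat.choose_le_choose _ (by omega)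
            · intro a ha
              obtain ⟨γ, _, rfl⟩ := List.mem_map.mp ha
              exact f.coeff_nonneg _
      _ = ∑ c ∈ Finset.univ.map ⟨e, he⟩,
          (((j :: l).splitWrtComposition c).map
            fun γ => f.coeff (FreeMonoid.ofList γ)).prod *
          ((c.length + m - 1).choose (m - 1) : ℝ) := by simp
      _ ≤ _ := Finset.sum_le_sum_of_subset_of_nonneg (Finset.subset_univ _)
          fun c _ _ => hnn c
  exact key _

/-! ### Tensor products of full Fock spaces and the universal model -/

variable {k : ℕ} {n : Fin k → ℕ}

/-- Tuples of words `(β₁, …, β_k)`, which index the orthonormal basis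
`e_{β₁} ⊗ ⋯ ⊗ e_{β_k}` of `F²(H_{n₁}) ⊗ ⋯ ⊗ F²(H_{n_k})`. -/
abbrev Words (n : Fin k → ℕ) : Type := ∀ i, FreeMonoid (Fin (n i))

/-- The Hilbert space `F²(H_{n₁}) ⊗ ⋯ ⊗ F²(H_{n_k}) ⊗ D`, as the square summable families of
vectors of `D` indexed by the orthonormal basis: `e_β ⊗ d` is `lp.single 2 β d`. -/
abbrev Fock (n : Fin k → ℕ) (D : Type v) [NormedAddCommGroup D] [InnerProductSpace ℂ D] :
    Type v := lp (fun _ : Words n => D) 2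

/-- Multiplication of the `i`-th word by the generator `g_j` on the left. -/
def consWord (i : Fin k) (j : Fin (n i)) (β : Words n) : Words n :=
  Function.update β i (FreeMonoid.of j * β i)

theorem consWord_injective (i : Fin k) (j : Fin (n i)) :
    Function.Injective (consWord (n := n) i j) := by
  intro β γ h
  funext l
  have hl := congrFun h l
  by_cases hli : l = i
  · subst hli
    simpa [consWord] using hl
  · simpa [consWord, hli] using hl

/-- The weight `√b_{β_i} / √b_{g_j β_i}` of the creation operator `W_{i,j}`. -/
def shiftWeight (f : ∀ i, PosRegular (n i)) (m : Fin k → ℕ) (i : Fin k) (j : Fin (n i))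
    (β : Words n) : ℝ :=
  √(weight (f i) (m i) (β i)) / √(weight (f i) (m i) (FreeMonoid.of j * β i))

theorem shiftWeight_nonneg (f : ∀ i, PosRegular (n i)) (m : Fin k → ℕ) (i : Fin k)
    (j : Fin (n i)) (β : Words n) : 0 ≤ shiftWeight f m i j β := by
  unfold shiftWeight; positivity

theorem shiftWeight_le (f : ∀ i, PosRegular (n i)) (m : Fin k → ℕ) (i : Fin k)
    (j : Fin (n i)) (β : Words n) :
    shiftWeight f m i j β ≤ 1 / √((f i).coeff (FreeMonoid.of j)) := by
  have ha := (f i).coeff_of_pos j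
  have h := coeff_mul_weight_le (f i) (m i) j (β i)
  have hs := Real.sqrt_le_sqrt h
  rw [Real.sqrt_mul ha.le] at hs
  have ha' := Real.sqrt_pos.mpr ha
  unfold shiftWeight
  rcases (Real.sqrt_nonneg (weight (f i) (m i) (FreeMonoid.of j * β i))).eq_or_lt with h0 | h0
  · rw [← h0, div_zero]; positivity
  · rw [div_le_div_iff₀ h0 ha']
    linarith

section Creation

variable {D : Type v} [NormedAddCommGroup D] [InnerProductSpace ℂ D]

/-- The coordinates of `(W_{i,j} ⊗ I_D) x`. -/
def creationFun (f : ∀ i, PosRegular (n i)) (m : Fin k → ℕ) (i : Fin k) (j : Fin (n i))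
    (x : Words n → D) : Words n → D :=
  Function.extend (consWord i j) (fun β => ((shiftWeight f m i j β : ℝ) : ℂ) • x β) 0

theorem creationFun_consWord (f : ∀ i, PosRegular (n i)) (m : Fin k → ℕ) (i : Fin k)
    (j : Fin (n i)) (x : Words n → D) (β : Words n) :
    creationFun f m i j x (consWord i j β) = ((shiftWeight f m i j β : ℝ) : ℂ) • x β :=
  (consWord_injective i j).extend_apply _ _ _

theorem creationFun_eq_zero (f : ∀ i, PosRegular (n i)) (m : Fin k → ℕ) (i : Fin k)
    (j : Fin (n i)) (x : Words n → D) {γ : Words n} (h : γ ∉ Set.range (consWord i j)) :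
    creationFun f m i j x γ = 0 := by
  unfold creationFun
  rw [Function.extend_apply' _ _ _ (fun ⟨a, ha⟩ => h ⟨a, ha⟩)]
  rfl

theorem creationFun_norm_sq_le (f : ∀ i, PosRegular (n i)) (m : Fin k → ℕ) (i : Fin k)
    (j : Fin (n i)) (x : Words n → D) (β : Words n) :
    ‖creationFun f m i j x (consWord i j β)‖ ^ (2 : ℝ≥0∞).toReal ≤
      (1 / √((f i).coeff (FreeMonoid.of j))) ^ 2 * ‖x β‖ ^ (2 : ℝ≥0∞).toReal := by
  rw [creationFun_consWord, norm_smul, Complex.norm_real, Real.norm_eq_abs,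
    abs_of_nonneg (shiftWeight_nonneg f m i j β)]
  simp only [ENNReal.toReal_ofNat, Real.rpow_ofNat]
  rw [mul_pow]
  exact mul_le_mul_of_nonneg_right (pow_le_pow_left₀ (shiftWeight_nonneg f m i j β)
    (shiftWeight_le f m i j β) 2) (by positivity)

theorem creationFun_zero_off (f : ∀ i, PosRegular (n i)) (m : Fin k → ℕ) (i : Fin k)
    (j : Fin (n i)) (x : Words n → D) (γ : Words n) (h : γ ∉ Set.range (consWord i j)) :
    ‖creationFun f m i j x γ‖ ^ (2 : ℝ≥0∞).toReal = 0 := by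
  rw [creationFun_eq_zero f m i j x h]; simp

theorem creationFun_memℓp (f : ∀ i, PosRegular (n i)) (m : Fin k → ℕ) (i : Fin k)
    (j : Fin (n i)) (x : Fock n D) :
    Memℓp (E := fun _ : Words n => D) (creationFun f m i j x) 2 := by
  apply memℓp_gen
  rw [← (consWord_injective i j).summable_iff (creationFun_zero_off f m i j x)]
  exact Summable.of_nonneg_of_le (fun _ => Real.rpow_nonneg (norm_nonneg _) _)
    (creationFun_norm_sq_le f m i j x)
    (((lp.memℓp x).summable (by norm_num)).mul_left _)

variable (D) in
/-- The operator `𝐖_{i,j} ⊗ I_D` on `F²(H_{n₁}) ⊗ ⋯ ⊗ F²(H_{n_k}) ⊗ D`, where `𝐖_{i,j}` is the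
weighted left creation operator `W_{i,j} e_α = √b_α / √b_{g_j α} e_{g_j α}` in the `i`-th factor;
see `universal_single`. -/
def universal (f : ∀ i, PosRegular (n i)) (m : Fin k → ℕ) (i : Fin k) (j : Fin (n i)) :
    Fock n D →L[ℂ] Fock n D :=
  LinearMap.mkContinuous
    { toFun := fun x => ⟨creationFun f m i j x, creationFun_memℓp f m i j x⟩
      map_add' := fun x y => by
        ext γ
        change creationFun f m i j (x + y : Fock n D) γ =
          creationFun f m i j x γ + creationFun f m i j y γ
        by_cases h : γ ∈ Set.range (consWord i j)
        · obtain ⟨β, rfl⟩ := h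
          simp only [creationFun_consWord, lp.coeFn_add, Pi.add_apply, smul_add]
        · simp only [creationFun_eq_zero f m i j _ h, add_zero]
      map_smul' := fun c x => by
        ext γ
        change creationFun f m i j (c • x : Fock n D) γ = c • creationFun f m i j x γ
        by_cases h : γ ∈ Set.range (consWord i j)
        · obtain ⟨β, rfl⟩ := h
          simp only [creationFun_consWord, lp.coeFn_smul, Pi.smul_apply]
          rw [smul_comm]
        · simp only [creationFun_eq_zero f m i j _ h, smul_zero] }
    (1 / √((f i).coeff (FreeMonoid.of j)))
    (fun x => by
      refine lp.norm_le_of_tsum_le (by norm_num) (by positivity) ?_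
      change ∑' γ, ‖creationFun f m i j x γ‖ ^ (2 : ℝ≥0∞).toReal ≤ _
      have hx := (lp.memℓp x).summable (p := 2) (by norm_num)
      have hsupp : Function.support
          (fun γ => ‖creationFun f m i j x γ‖ ^ (2 : ℝ≥0∞).toReal) ⊆
          Set.range (consWord i j) := fun γ hγ => by
        by_contra h
        exact hγ (creationFun_zero_off f m i j x γ h)
      rw [← (consWord_injective i j).tsum_eq hsupp,
        Real.mul_rpow (div_nonneg zero_le_one (Real.sqrt_nonneg _)) (norm_nonneg _), lp.norm_rpow_eq_tsum (by norm_num) x,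
        ← tsum_mul_left]
      refine Summable.tsum_le_tsum ?_ ?_ (hx.mul_left _)
      · intro β
        refine (creationFun_norm_sq_le f m i j x β).trans_eq ?_
        simp
      · refine Summable.of_nonneg_of_le (fun _ => by positivity)
          (creationFun_norm_sq_le f m i j x) (hx.mul_left _))

open Classical in
theorem universal_single (f : ∀ i, PosRegular (n i)) (m : Fin k → ℕ) (i : Fin k)
    (j : Fin (n i)) (β : Words n) (d : D) :
    universal D f m i j (lp.single 2 β d) =
      lp.single 2 (consWord i j β)
        (((√(weight (f i) (m i) (β i)) /
          √(weight (f i) (m i) (FreeMonoid.of j * β i)) : ℝ) : ℂ) • d) := by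
  ext γ
  change creationFun f m i j (lp.single 2 β d : Fock n D) γ = _
  by_cases h : γ ∈ Set.range (consWord i j)
  · obtain ⟨δ, rfl⟩ := h
    rw [creationFun_consWord]
    by_cases hδ : δ = β
    · subst hδ
      simp [shiftWeight]
    · rw [lp.single_apply_ne _ _ _ hδ,
        lp.single_apply_ne _ _ _ ((consWord_injective i j).ne hδ), smul_zero]
  · rw [creationFun_eq_zero f m i j _ h, lp.single_apply_ne]
    rintro rfl
    exact h ⟨β, rfl⟩

end Creation

/-! ### The noncommutative polydomain -/

section Domain

variable {H : Type u} [NormedAddCommGroup H] [InnerProductSpace ℂ H] [CompleteSpace H]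

/-- The elements of `B(H)^{n₁} × ⋯ × B(H)^{n_k}`. -/
abbrev OpTuple (n : Fin k → ℕ) (H : Type u) [NormedAddCommGroup H] [InnerProductSpace ℂ H] :
    Type u := ∀ i, Fin (n i) → (H →L[ℂ] H)

/-- `X_α = X_{j₁} ⋯ X_{j_p}` for the word `α = g_{j₁} ⋯ g_{j_p}`. -/
def wordOp {N : ℕ} (X : Fin N → (H →L[ℂ] H)) (α : FreeMonoid (Fin N)) : H →L[ℂ] H :=
  FreeMonoid.lift X α

/-- The term `a_α X_α Y X_α^*`, in `B(H)` with the weak operator topology. -/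
def phiTerm {N : ℕ} (f : PosRegular N) (X : Fin N → (H →L[ℂ] H)) (Y : H →L[ℂ] H)
    (α : FreeMonoid (Fin N)) : H →WOT[ℂ] H :=
  ContinuousLinearMapWOT.ofCLM
    ((f.coeff α : ℂ) • (wordOp X α ∘L Y ∘L ContinuousLinearMap.adjoint (wordOp X α)))

/-- `Φ_{f,X}(Y) = ∑_α a_α X_α Y X_α^*`, convergent in the weak operator topology. -/
def phi {N : ℕ} (f : PosRegular N) (X : Fin N → (H →L[ℂ] H)) (Y : H →L[ℂ] H) : H →L[ℂ] H :=
  (∑' α, phiTerm f X Y α).toCLM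

/-- `Δ_{f,X}^p(Y) = (id - Φ_{f₁,X₁})^{p₁} ∘ ⋯ ∘ (id - Φ_{f_k,X_k})^{p_k} (Y)`. -/
def defect (f : ∀ i, PosRegular (n i)) (X : OpTuple n H) (p : Fin k → ℕ) (Y : H →L[ℂ] H) :
    H →L[ℂ] H :=
  (List.finRange k).foldr (fun i Z => (fun Y' => Y' - phi (f i) (X i) Y')^[p i] Z) Y

/-- The noncommutative polydomain `D_f^m(H)`. -/
structure MemPolydomain (f : ∀ i, PosRegular (n i)) (m : Fin k → ℕ) (X : OpTuple n H) :
    Prop where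
  commute : ∀ p q, p ≠ q → ∀ a b, Commute (X p a) (X q b)
  summable : ∀ i, Summable (phiTerm (f i) (X i) 1)
  phi_le : ∀ i, phi (f i) (X i) 1 ≤ 1
  defect_nonneg : ∀ ε : Fin k → ℕ, (∀ i, ε i = 0 ∨ ε i = 1) →
    0 ≤ defect f X (fun i => ε i * m i) 1

/-- `(id - Φ_{f_k,X_k}^{q_k}) ∘ ⋯ ∘ (id - Φ_{f₁,X₁}^{q₁}) (I)`. -/
def pureNet (f : ∀ i, PosRegular (n i)) (X : OpTuple n H) (q : Fin k → ℕ) : H →L[ℂ] H :=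
  (List.finRange k).foldl (fun Z i => Z - (phi (f i) (X i))^[q i] Z) 1

/-- `(id - Φ_{f₁,X₁}^{q₁}) ∘ ⋯ ∘ (id - Φ_{f_k,X_k}^{q_k}) (I)`. -/
def cncNet (f : ∀ i, PosRegular (n i)) (X : OpTuple n H) (q : Fin k → ℕ) : H →L[ℂ] H :=
  (List.finRange k).foldr (fun i Z => Z - (phi (f i) (X i))^[q i] Z) 1

/-- Pure tuples: `lim_{q ∈ ℤ₊^k} (id - Φ_{f_k,X_k}^{q_k}) ⋯ (id - Φ_{f₁,X₁}^{q₁}) (I) = I`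
in the weak operator topology. -/
def IsPure (f : ∀ i, PosRegular (n i)) (X : OpTuple n H) : Prop :=
  Filter.Tendsto (fun q : Fin k → ℕ => ContinuousLinearMapWOT.ofCLM (pureNet f X q))
    Filter.atTop (nhds (ContinuousLinearMapWOT.ofCLM (1 : H →L[ℂ] H)))

/-- Completely non-coisometric tuples. -/
def IsCNC (f : ∀ i, PosRegular (n i)) (X : OpTuple n H) : Prop :=
  ¬ ∃ h : H, h ≠ 0 ∧ ∀ q : Fin k → ℕ, (∀ i, 1 ≤ q i) → inner ℂ (cncNet f X q h) h = 0

/-- The defect space: the closure of the range of `Δ_{f,X}^m(I)`. -/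
abbrev defectSpace (f : ∀ i, PosRegular (n i)) (m : Fin k → ℕ) (X : OpTuple n H) :
    Submodule ℂ H :=
  (LinearMap.range (defect f X m 1).toLinearMap).topologicalClosure

/-- The positive square root of a positive operator. -/
def opSqrt (A : H →L[ℂ] H) : H →L[ℂ] H := CFC.sqrt A

/-! ### The noncommutative Berezin kernel -/

/-- `K` is the noncommutative Berezin kernel of `X`:
`K h = ∑_β √b_{β₁} ⋯ √b_{β_k} e_β ⊗ Δ_{f,X}^m(I)^{1/2} X_{1,β₁}^* ⋯ X_{k,β_k}^* h`. -/
def IsBerezinKernel (f : ∀ i, PosRegular (n i)) (m : Fin k → ℕ) (X : OpTuple n H)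
    (K : H →L[ℂ] Fock n (defectSpace f m X)) : Prop :=
  ∀ (h : H) (β : Words n), ((K h β : defectSpace f m X) : H) =
    ((∏ i, √(weight (f i) (m i) (β i)) : ℝ) : ℂ) •
      opSqrt (defect f X m 1)
        (((List.finRange k).map
          fun i => ContinuousLinearMap.adjoint (wordOp (X i) (β i))).prod h)

open Classical in
/-- The noncommutative Berezin kernel `K_{f,X}`. It exists, and is unique, for every `X` in the
polydomain (elsewhere the value is `0` if there is none). -/
def berezinKernel (f : ∀ i, PosRegular (n i)) (m : Fin k → ℕ) (X : OpTuple n H) :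
    H →L[ℂ] Fock n (defectSpace f m X) :=
  if h : ∃ K, IsBerezinKernel f m X K then h.choose else 0

/-- The adjoint `K_{f,X}^*` of the Berezin kernel. -/
def berezinAdjoint (f : ∀ i, PosRegular (n i)) (m : Fin k → ℕ) (X : OpTuple n H) :
    Fock n (defectSpace f m X) →L[ℂ] H :=
  ContinuousLinearMap.adjoint (berezinKernel f m X)

/-! ### Multi-analytic operators and characteristic functions -/

/-- Multi-analytic operators with respect to the universal model. -/
def IsMultiAnalytic (f : ∀ i, PosRegular (n i)) (m : Fin k → ℕ)
    {E : Type u} [NormedAddCommGroup E] [InnerProductSpace ℂ E]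
    {G : Type v} [NormedAddCommGroup G] [InnerProductSpace ℂ G]
    (M : Fock n E →L[ℂ] Fock n G) : Prop :=
  ∀ i j, M ∘L universal E f m i j = universal G f m i j ∘L M

/-- Partial isometries: isometric on the orthogonal complement of the kernel. -/
def IsPartialIsometry {E : Type u} [NormedAddCommGroup E] [InnerProductSpace ℂ E]
    {G : Type v} [NormedAddCommGroup G] [InnerProductSpace ℂ G] (M : E →L[ℂ] G) : Prop :=
  ∀ x ∈ (LinearMap.ker M.toLinearMap)ᗮ, ‖M x‖ = ‖x‖

/-- Inner multi-analytic operators. -/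
def IsInner (f : ∀ i, PosRegular (n i)) (m : Fin k → ℕ)
    {E : Type u} [NormedAddCommGroup E] [InnerProductSpace ℂ E]
    {G : Type v} [NormedAddCommGroup G] [InnerProductSpace ℂ G]
    (M : Fock n E →L[ℂ] Fock n G) : Prop :=
  IsMultiAnalytic f m M ∧ IsPartialIsometry M

/-- The class `C_f^m(H)`: the tuples `X` in the polydomain which have a characteristic function,
that is, `K K^* + Ψ Ψ^* = I` for some multi-analytic operator `Ψ`, where `K` is the Berezin kernel
of `X`. -/
def HasCharFun (f : ∀ i, PosRegular (n i)) (m : Fin k → ℕ) (X : OpTuple n H) : Prop :=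
  MemPolydomain f m X ∧
  ∃ (E : Type u) (_ : NormedAddCommGroup E) (_ : InnerProductSpace ℂ E) (_ : CompleteSpace E)
    (Ψ : Fock n E →L[ℂ] Fock n (defectSpace f m X)),
    IsMultiAnalytic f m Ψ ∧
    berezinKernel f m X ∘L berezinAdjoint f m X +
      Ψ ∘L ContinuousLinearMap.adjoint Ψ = 1

/-- `I - K K^*`, where `K` is the Berezin kernel of `X`. -/
def kernelDefect (f : ∀ i, PosRegular (n i)) (m : Fin k → ℕ) (X : OpTuple n H) :
    Fock n (defectSpace f m X) →L[ℂ] Fock n (defectSpace f m X) :=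
  1 - berezinKernel f m X ∘L berezinAdjoint f m X

/-- The space `M_X`: the closure of the range of `I - K K^*`. -/
abbrev kernelDefectSpace (f : ∀ i, PosRegular (n i)) (m : Fin k → ℕ) (X : OpTuple n H) :
    Submodule ℂ (Fock n (defectSpace f m X)) :=
  (LinearMap.range (kernelDefect f m X).toLinearMap).topologicalClosure

/-- `A` is the operator `A_{i,j}` on `M_X` determined by
`A (I - K K^*)^{1/2} x = (I - K K^*)^{1/2} (𝐖_{i,j}^* ⊗ I) x` for all `x`. -/
def IsCompanionAdjoint (f : ∀ i, PosRegular (n i)) (m : Fin k → ℕ) (X : OpTuple n H)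
    (i : Fin k) (j : Fin (n i))
    (A : kernelDefectSpace f m X →L[ℂ] kernelDefectSpace f m X) : Prop :=
  ∀ (x : Fock n (defectSpace f m X)) (y : kernelDefectSpace f m X),
    (y : Fock n (defectSpace f m X)) = opSqrt (kernelDefect f m X) x →
    (A y : Fock n (defectSpace f m X)) =
      opSqrt (kernelDefect f m X)
        (ContinuousLinearMap.adjoint (universal (defectSpace f m X) f m i j) x)

open Classical in
/-- The operators `A_{i,j}` (with value `0` if there is no such operator, which does not happen
for tuples with a characteristic function). -/
def companionAdjoint (f : ∀ i, PosRegular (n i)) (m : Fin k → ℕ) (X : OpTuple n H)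
    (i : Fin k) (j : Fin (n i)) : kernelDefectSpace f m X →L[ℂ] kernelDefectSpace f m X :=
  if h : ∃ A, IsCompanionAdjoint f m X i j A then h.choose else 0

/-- The tuple `M_X = (A_{i,j}^*)` on the space `M_X`. -/
def companion (f : ∀ i, PosRegular (n i)) (m : Fin k → ℕ) (X : OpTuple n H) :
    OpTuple n (kernelDefectSpace f m X) :=
  fun i j => ContinuousLinearMap.adjoint (companionAdjoint f m X i j)

/-- The characteristic function `Θ_{f,X} = (I - K_{f,X} K_{f,X}^*)^{1/2} K_{f,M_X}^*`. -/
def charFun (f : ∀ i, PosRegular (n i)) (m : Fin k → ℕ) (X : OpTuple n H) :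
    Fock n (defectSpace f m (companion f m X)) →L[ℂ] Fock n (defectSpace f m X) :=
  opSqrt (kernelDefect f m X) ∘L (kernelDefectSpace f m X).subtypeL ∘L
    berezinAdjoint f m (companion f m X)

/-! ### The operator model -/

/-- The model space: the orthogonal complement of the range of `Θ_{f,X}`. -/
abbrev modelSpace (f : ∀ i, PosRegular (n i)) (m : Fin k → ℕ) (X : OpTuple n H) :
    Submodule ℂ (Fock n (defectSpace f m X)) :=
  (LinearMap.range (charFun f m X).toLinearMap)ᗮ

/-- The compressions `G_{i,j}` of `𝐖_{i,j} ⊗ I` to the model space. -/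
def modelTuple (f : ∀ i, PosRegular (n i)) (m : Fin k → ℕ) (X : OpTuple n H) :
    OpTuple n (modelSpace f m X) :=
  fun i j => (modelSpace f m X).orthogonalProjectionOnto ∘L
    universal (defectSpace f m X) f m i j ∘L (modelSpace f m X).subtypeL

/-- Unitary equivalence of tuples: `X_{i,j} = U^* X'_{i,j} U` for a unitary operator `U`. -/
def UnitarilyEquivalent {H' : Type v} [NormedAddCommGroup H'] [InnerProductSpace ℂ H']
    (X : OpTuple n H) (X' : OpTuple n H') : Prop :=
  ∃ U : H ≃ₗᵢ[ℂ] H', ∀ i j h, X i j h = U.symm (X' i j (U h))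

end Domain

end Polydomain

end

open Polydomain

/-!
The weights `b_{i,α}` are the coefficients of `(1 - f_i)^{-m_i}`. Hence `‖K_{f,X} h‖²` is the limit,
in fact the supremum over `q`, of the forms `⟨∏_i (1 - Φ_{f_i,X_i}^{q_i})(1) h, h⟩`, so that `X` is
pure if and only if `K_{f,X}` is isometric, and `K_{f,X}` is injective if `X` is completely
non-coisometric. The universal model `W` is pure, and its defect is the vacuum projection.

A factorization `1 - K_{f,T} K_{f,T}^* = Ψ Ψ^*` with `Ψ` multi-analytic embeds `M_T` as the
compression of `W ⊗ 1` to a subspace which is invariant under all `W_{i,j}^* ⊗ 1`. Therefore the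
Berezin kernel of `M_T` is isometric, which gives `K_{f,T} K_{f,T}^* + Θ_{f,T} Θ_{f,T}^* = 1`.
Consequently `Θ_{f,T}` is a partial isometry if and only if `K_{f,T}` is. An injective partial
isometry is isometric, and an isometric `K_{f,T}` is a unitary from `H` onto the complement of the
range of `Θ_{f,T}` which intertwines `T_{i,j}^*` with `W_{i,j}^* ⊗ 1`.
-/

namespace Polydomain

open ContinuousLinearMap (adjoint)

/-! ### Factorizations of words -/

section Factorizations

variable {ι : Type*}

/-- The factorization of the word `α` into nonempty words along a composition of its length. -/
def splitWords (α : FreeMonoid ι) (c : Composition (FreeMonoid.toList α).length) :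
    List (FreeMonoid ι) :=
  ((FreeMonoid.toList α).splitWrtComposition c).map FreeMonoid.ofList

theorem map_length_splitWords (α : FreeMonoid ι) (c : Composition (FreeMonoid.toList α).length) :
    (splitWords α c).map (fun w => (FreeMonoid.toList w).length) = c.blocks := by
  rw [splitWords, List.map_map]
  exact List.map_length_splitWrtComposition _ c

theorem length_splitWords (α : FreeMonoid ι) (c : Composition (FreeMonoid.toList α).length) :
    (splitWords α c).length = c.length := by
  rw [splitWords, List.length_map, List.length_splitWrtComposition]

theorem splitWords_injective (α : FreeMonoid ι) : Function.Injective (splitWords α) :=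
  fun c d h => Composition.ext <| by rw [← map_length_splitWords, h, map_length_splitWords]

theorem prod_splitWords (α : FreeMonoid ι) (c : Composition (FreeMonoid.toList α).length) :
    (splitWords α c).prod = α := by
  rw [splitWords, ← FreeMonoid.ofList_flatten, List.flatten_splitWrtComposition,
    FreeMonoid.ofList_toList]

theorem mem_range_splitWords {L : List (FreeMonoid ι)} (hL : ∀ w ∈ L, w ≠ 1) :
    L ∈ Set.range (splitWords L.prod) := by
  have hflat : FreeMonoid.toList L.prod = (L.map FreeMonoid.toList).flatten :=
    FreeMonoid.toList_prod L
  have hblocks : (L.map fun w => (FreeMonoid.toList w).length).sum =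
      (FreeMonoid.toList L.prod).length := by
    rw [hflat, List.length_flatten, List.map_map]
    rfl
  have hsplit : ∀ (l : List ι) (L' : List (List ι)), l = L'.flatten →
      ∀ c : Composition l.length, c.blocks = L'.map List.length → l.splitWrtComposition c = L' := by
    rintro l L' rfl c hc
    exact List.splitWrtComposition_flatten L' c hc.symm
  refine ⟨⟨L.map fun w => (FreeMonoid.toList w).length, ?_, hblocks⟩, ?_⟩
  · intro _ hlen
    obtain ⟨w, hw, rfl⟩ := List.mem_map.mp hlen
    exact List.length_pos_iff.mpr fun h => hL w hw (FreeMonoid.toList.injective h)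
  · rw [splitWords, hsplit _ _ hflat _ List.map_map.symm, List.map_map]
    simp

theorem tsum_list_eq_add_tsum_cons (G : List ι → ℝ≥0∞) :
    ∑' L, G L = G [] + ∑' x, ∑' L, G (x :: L) := by
  let e : Option (ι × List ι) ≃ List ι :=
    { toFun := fun o => o.elim [] fun p => p.1 :: p.2
      invFun := fun L => match L with
        | [] => none
        | x :: L => some (x, L)
      left_inv := by rintro (_ | ⟨x, L⟩) <;> rfl
      right_inv := by rintro (_ | ⟨x, L⟩) <;> rfl }
  rw [← e.tsum_eq, ENNReal.tsum_eq_add_tsum_ite none,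
    ← ENNReal.tsum_prod (f := fun x L => G (x :: L)), ← (Option.some_injective _).tsum_eq]
  · simp [e]
  · rintro (_ | o) ho
    · simp at ho
    · exact ⟨o, rfl⟩

end Factorizations

section Weights

variable {N : ℕ} (f : PosRegular N)

/-- The coefficient `a_α` as an extended nonnegative real number. -/
noncomputable def ecoeff (α : FreeMonoid (Fin N)) : ℝ≥0∞ := ENNReal.ofReal (f.coeff α)

/-- The weight `b_α^{(m)}` as an extended nonnegative real number. -/
noncomputable def eweight (m : ℕ) (α : FreeMonoid (Fin N)) : ℝ≥0∞ :=
  ENNReal.ofReal (weight f m α)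

theorem ecoeff_one : ecoeff f 1 = 0 := by
  rw [ecoeff, f.coeff_one, ENNReal.ofReal_zero]

theorem ofReal_prod_coeff (L : List (FreeMonoid (Fin N))) :
    ENNReal.ofReal (L.map f.coeff).prod = (L.map (ecoeff f)).prod := by
  induction L with
  | nil => simp only [List.map_nil, List.prod_nil, ENNReal.ofReal_one]
  | cons α L ih =>
    rw [List.map_cons, List.map_cons, List.prod_cons, List.prod_cons,
      ENNReal.ofReal_mul (f.coeff_nonneg α), ih, ecoeff]

theorem eweight_eq_sum_splitWords (m : ℕ) (α : FreeMonoid (Fin N)) :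
    eweight f m α = ∑ c, ((splitWords α c).map (ecoeff f)).prod *
      (((splitWords α c).length + m - 1).choose (m - 1) : ℝ≥0∞) := by
  have hnonneg : ∀ L : List (FreeMonoid (Fin N)), 0 ≤ (L.map f.coeff).prod := fun L =>
    List.prod_nonneg <| List.forall_mem_map.mpr fun γ _ => f.coeff_nonneg γ
  have hsplit : ∀ c, (((FreeMonoid.toList α).splitWrtComposition c).map
      fun γ => f.coeff (FreeMonoid.ofList γ)).prod = ((splitWords α c).map f.coeff).prod :=
    fun c => by rw [splitWords, List.map_map]; rfl
  simp only [eweight, weight, hsplit, length_splitWords]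
  rw [ENNReal.ofReal_sum_of_nonneg fun c _ => mul_nonneg (hnonneg _) (Nat.cast_nonneg _)]
  refine Finset.sum_congr rfl fun c _ => ?_
  rw [ENNReal.ofReal_mul (hnonneg _), ENNReal.ofReal_natCast, ofReal_prod_coeff]

/-- Since `a_1 = 0`, factorizations with empty factors may be included in the sum defining the
weight. -/
theorem eweight_eq_tsum [DecidableEq (FreeMonoid (Fin N))] (m : ℕ) (α : FreeMonoid (Fin N)) :
    eweight f m α = ∑' L : List (FreeMonoid (Fin N)), if L.prod = α then
      (L.map (ecoeff f)).prod * ((L.length + m - 1).choose (m - 1) : ℝ≥0∞) else 0 := by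
  rw [eweight_eq_sum_splitWords, ← tsum_fintype (L := .unconditional _),
    ← (splitWords_injective α).tsum_eq]
  · exact tsum_congr fun c => (if_pos (prod_splitWords α c)).symm
  · intro L hL
    obtain ⟨rfl, hL'⟩ := ite_ne_right_iff.mp hL
    refine mem_range_splitWords fun w hw hw1 => hL' ?_
    rw [List.prod_eq_zero (List.mem_map.mpr ⟨w, hw, hw1 ▸ ecoeff_one f⟩), zero_mul]

theorem weight_pos (m : ℕ) (α : FreeMonoid (Fin N)) : 0 < weight f m α := by
  induction α using FreeMonoid.inductionOn' with
  | one => exact (weight_one f m).symm ▸ one_pos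
  | of_mul a α ih =>
    exact (mul_pos (f.coeff_of_pos a) ih).trans_le (coeff_mul_weight_le f m a α)

end Weights

/-! ### Word forms -/

section WordForms

variable {H : Type*} [NormedAddCommGroup H] [InnerProductSpace ℂ H]
variable {M N : ℕ}

theorem wordOp_of (X : Fin N → (H →L[ℂ] H)) (j : Fin N) : wordOp X (FreeMonoid.of j) = X j :=
  FreeMonoid.lift_eval_of X j

theorem commute_wordOp_right {A : H →L[ℂ] H} {Z : Fin M → (H →L[ℂ] H)}
    (h : ∀ b, Commute A (Z b)) (α : FreeMonoid (Fin M)) : Commute A (wordOp Z α) := by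
  induction α using FreeMonoid.inductionOn' with
  | one => rw [wordOp, map_one]; exact Commute.one_right A
  | of_mul b α ih =>
    rw [wordOp, map_mul, FreeMonoid.lift_eval_of]
    exact (h b).mul_right ih

theorem commute_wordOp {X : Fin N → (H →L[ℂ] H)} {Z : Fin M → (H →L[ℂ] H)}
    (h : ∀ a b, Commute (X a) (Z b)) (α : FreeMonoid (Fin N)) (β : FreeMonoid (Fin M)) :
    Commute (wordOp X α) (wordOp Z β) :=
  commute_wordOp_right (fun b => (commute_wordOp_right (fun a => (h a b).symm) α).symm) β

variable [CompleteSpace H] (c : FreeMonoid (Fin N) → ℝ≥0∞) (X : Fin N → (H →L[ℂ] H))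

/-- The action `q ↦ ∑_α c_α q(X_α^* ·)` on functions `H → [0, ∞]` which corresponds to the map
`Y ↦ ∑_α c_α X_α Y X_α^*` on positive operators. Working with `[0, ∞]`-valued functions makes all
series converge. -/
noncomputable def wordForm (q : H → ℝ≥0∞) (h : H) : ℝ≥0∞ :=
  ∑' α, c α * q (adjoint (wordOp X α) h)

/-- The geometric series of the iterates of `wordForm c X`. -/
noncomputable def geomForm (q : H → ℝ≥0∞) (h : H) : ℝ≥0∞ :=
  ∑' p : ℕ, (wordForm c X)^[p] q h

theorem adjoint_wordOp_mul (α β : FreeMonoid (Fin N)) (h : H) :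
    adjoint (wordOp X (α * β)) h = adjoint (wordOp X β) (adjoint (wordOp X α) h) := by
  rw [wordOp, map_mul, ContinuousLinearMap.mul_def, ContinuousLinearMap.adjoint_comp]
  rfl

theorem adjoint_wordOp_one (h : H) : adjoint (wordOp X 1) h = h := by
  rw [wordOp, map_one, ContinuousLinearMap.one_def, ContinuousLinearMap.adjoint_id]
  rfl

theorem wordForm_tsum {ι : Type*} (d : ι → ℝ≥0∞) (q : ι → H → ℝ≥0∞) :
    wordForm c X (fun h => ∑' j, d j * q j h) = fun h => ∑' j, d j * wordForm c X (q j) h := by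
  funext h
  simp only [wordForm, ← ENNReal.tsum_mul_left]
  rw [ENNReal.tsum_comm]
  exact tsum_congr fun j => tsum_congr fun α => mul_left_comm _ _ _

theorem wordForm_iterate_tsum {ι : Type*} (d : ι → ℝ≥0∞) (q : ι → H → ℝ≥0∞) (p : ℕ) :
    (wordForm c X)^[p] (fun h => ∑' j, d j * q j h) =
      fun h => ∑' j, d j * (wordForm c X)^[p] (q j) h := by
  induction p with
  | zero => rfl
  | succ p ih => simp only [Function.iterate_succ_apply', ih, wordForm_tsum]

theorem wordForm_mono : Monotone (wordForm c X) := fun _ _ hq _ =>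
  ENNReal.tsum_le_tsum fun _ => mul_le_mul_right (hq _) _

theorem geomForm_eq (q : H → ℝ≥0∞) (h : H) :
    geomForm c X q h = q h + wordForm c X (geomForm c X q) h := by
  have hshift := congrFun (wordForm_tsum c X (fun _ : ℕ => 1) fun p => (wordForm c X)^[p] q) h
  simp only [one_mul, ← Function.iterate_succ_apply' (wordForm c X)] at hshift
  exact (tsum_eq_zero_add' ENNReal.summable).trans (congrArg (q h + ·) hshift.symm)

theorem wordForm_geomForm_le (q : H → ℝ≥0∞) :
    wordForm c X (geomForm c X q) ≤ geomForm c X q := fun h =>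
  le_add_self.trans_eq (geomForm_eq c X q h).symm

theorem wordForm_iterate (q : H → ℝ≥0∞) (p : ℕ) (h : H) :
    (wordForm c X)^[p] q h = ∑' L : List (FreeMonoid (Fin N)),
      if L.length = p then (L.map c).prod * q (adjoint (wordOp X L.prod) h) else 0 := by
  induction p generalizing h with
  | zero =>
    rw [tsum_list_eq_add_tsum_cons]
    simp [adjoint_wordOp_one]
  | succ p ih =>
    rw [tsum_list_eq_add_tsum_cons, Function.iterate_succ_apply', wordForm]
    simp only [ih, List.length_nil, List.length_cons, add_left_inj, List.map_cons, List.prod_cons,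
      adjoint_wordOp_mul, ← ENNReal.tsum_mul_left, mul_ite, mul_zero, mul_assoc]
    simp

theorem sum_antidiagonal_add_choose (m p : ℕ) :
    ∑ x ∈ Finset.HasAntidiagonal.antidiagonal p, (x.2 + m).choose m =
      (p + (m + 1)).choose (m + 1) := by
  rw [Finset.Nat.sum_antidiagonal_eq_sum_range_succ_mk,
    Finset.sum_flip (fun j => (j + m).choose m), Nat.sum_range_add_choose, add_assoc]

theorem geomForm_iterate (m : ℕ) (q : H → ℝ≥0∞) (h : H) :
    (geomForm c X)^[m + 1] q h =
      ∑' p : ℕ, ((p + m).choose m : ℝ≥0∞) * (wordForm c X)^[p] q h := by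
  induction m generalizing h with
  | zero => simp [geomForm]
  | succ m ih =>
    rw [Function.iterate_succ_apply', funext ih]
    simp only [geomForm, wordForm_iterate_tsum, ← Function.iterate_add_apply]
    rw [← ENNReal.tsum_prod
        (f := fun r p => ((p + m).choose m : ℝ≥0∞) * (wordForm c X)^[r + p] q h),
      ← Finset.HasAntidiagonal.sigmaAntidiagonalEquivProd.tsum_eq, ENNReal.tsum_sigma']
    refine tsum_congr fun p => ?_
    calc _ = ∑ x ∈ Finset.HasAntidiagonal.antidiagonal p,
          ((x.2 + m).choose m : ℝ≥0∞) * (wordForm c X)^[x.1 + x.2] q h :=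
        Finset.tsum_subtype (Finset.HasAntidiagonal.antidiagonal p) fun x : ℕ × ℕ =>
          ((x.2 + m).choose m : ℝ≥0∞) * (wordForm c X)^[x.1 + x.2] q h
      _ = ∑ x ∈ Finset.HasAntidiagonal.antidiagonal p,
          ((x.2 + m).choose m : ℝ≥0∞) * (wordForm c X)^[p] q h :=
        Finset.sum_congr rfl fun x hx => by rw [Finset.HasAntidiagonal.mem_antidiagonal.mp hx]
      _ = _ := by
        rw [← Finset.sum_mul, ← Nat.cast_sum, sum_antidiagonal_add_choose]

theorem wordForm_eweight_eq_tsum (f : PosRegular N) (m : ℕ) (q : H → ℝ≥0∞) (h : H) :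
    wordForm (eweight f m) X q h =
      ∑' p : ℕ, ((p + m - 1).choose (m - 1) : ℝ≥0∞) * (wordForm (ecoeff f) X)^[p] q h := by
  classical
  calc wordForm (eweight f m) X q h
      = ∑' L : List (FreeMonoid (Fin N)), (L.map (ecoeff f)).prod *
          ((L.length + m - 1).choose (m - 1) : ℝ≥0∞) * q (adjoint (wordOp X L.prod) h) := by
        simp only [wordForm, eweight_eq_tsum, ← ENNReal.tsum_mul_right, ite_mul, zero_mul]
        rw [ENNReal.tsum_comm]
        refine tsum_congr fun L => ?_
        rw [tsum_eq_single L.prod fun α hα => if_neg hα.symm, if_pos rfl]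
    _ = ∑' p : ℕ, ((p + m - 1).choose (m - 1) : ℝ≥0∞) * (wordForm (ecoeff f) X)^[p] q h := by
        simp only [wordForm_iterate, ← ENNReal.tsum_mul_left]
        rw [ENNReal.tsum_comm]
        refine tsum_congr fun L => ?_
        rw [tsum_eq_single L.length fun p hp => by rw [if_neg hp.symm, mul_zero], if_pos rfl]
        ring

/-- This is where the binomial coefficients in the weights come from: the weights are the
coefficients of `(1 - f)⁻ᵐ`. -/
theorem wordForm_eweight (f : PosRegular N) {m : ℕ} (hm : 1 ≤ m) :
    wordForm (eweight f m) X = (geomForm (ecoeff f) X)^[m] := by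
  obtain ⟨m, rfl⟩ := Nat.exists_eq_add_of_le' hm
  funext q h
  rw [geomForm_iterate, wordForm_eweight_eq_tsum]
  rfl

variable {X} {Z : Fin M → (H →L[ℂ] H)}

theorem commute_adjoint {A B : H →L[ℂ] H} (h : Commute A B) : Commute (adjoint A) (adjoint B) :=
  h.star_star

theorem wordForm_comm (d : FreeMonoid (Fin M) → ℝ≥0∞) (h : ∀ a b, Commute (X a) (Z b))
    (q : H → ℝ≥0∞) :
    wordForm c X (wordForm d Z q) = wordForm d Z (wordForm c X q) := by
  funext x
  simp only [wordForm, ← ENNReal.tsum_mul_left]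
  rw [ENNReal.tsum_comm]
  refine tsum_congr fun β => tsum_congr fun α => ?_
  have hαβ : adjoint (wordOp X α) (adjoint (wordOp Z β) x) =
      adjoint (wordOp Z β) (adjoint (wordOp X α) x) :=
    DFunLike.congr_fun (commute_adjoint (commute_wordOp h α β)).eq x
  rw [hαβ, mul_left_comm]

end WordForms

/-! ### Columns of operators -/

section Columns

variable {ι H G : Type*} [NormedAddCommGroup H] [InnerProductSpace ℂ H] [NormedAddCommGroup G]

theorem ofReal_norm_sq_eq_tsum (x : lp (fun _ : ι => G) 2) :
    ENNReal.ofReal (‖x‖ ^ 2) = ∑' i, ENNReal.ofReal (‖x i‖ ^ 2) := by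
  have hnorm := lp.norm_rpow_eq_tsum (p := 2) (by norm_num) x
  have hsum := (lp.memℓp x).summable (p := 2) (by norm_num)
  simp only [ENNReal.toReal_ofNat, Real.rpow_ofNat] at hnorm hsum
  rw [hnorm, ENNReal.ofReal_tsum_of_nonneg (fun _ => by positivity) hsum]

variable [InnerProductSpace ℂ G]

theorem exists_column (B : ι → H →L[ℂ] G) {C : ℝ} (hC : 0 ≤ C)
    (hB : ∀ h, ∑' i, ENNReal.ofReal (‖B i h‖ ^ 2) ≤ ENNReal.ofReal (C * ‖h‖ ^ 2)) :
    ∃ V : H →L[ℂ] lp (fun _ : ι => G) 2, ∀ h i, V h i = B i h := by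
  have hsum : ∀ h, Summable fun i => ‖B i h‖ ^ 2 := fun h => by
    simpa only [ENNReal.toReal_ofReal (sq_nonneg _)] using
      ENNReal.summable_toReal (ne_top_of_le_ne_top ENNReal.ofReal_ne_top (hB h))
  have hmem : ∀ h, Memℓp (E := fun _ : ι => G) (fun i => B i h) 2 := fun h =>
    memℓp_gen (by simpa using hsum h)
  let V : H →ₗ[ℂ] lp (fun _ : ι => G) 2 :=
    { toFun := fun h => ⟨fun i => B i h, hmem h⟩
      map_add' := fun x y => by ext i; exact map_add (B i) x y
      map_smul' := fun c x => by ext i; exact map_smul (B i) c x }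
  refine ⟨V.mkContinuous (√C) fun h => ?_, fun h i => rfl⟩
  have hV : ‖V h‖ ^ 2 ≤ C * ‖h‖ ^ 2 := by
    rw [← ENNReal.ofReal_le_ofReal_iff (by positivity), ofReal_norm_sq_eq_tsum]
    exact hB h
  calc ‖V h‖ ≤ √(C * ‖h‖ ^ 2) := (Real.le_sqrt (norm_nonneg _) (by positivity)).mpr hV
    _ = √C * ‖h‖ := by rw [Real.sqrt_mul hC, Real.sqrt_sq (norm_nonneg _)]

theorem ofReal_norm_sqrt_smul_sq {a : ℝ} (ha : 0 ≤ a) (x : G) :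
    ENNReal.ofReal (‖((√a : ℝ) : ℂ) • x‖ ^ 2) =
      ENNReal.ofReal a * ENNReal.ofReal (‖x‖ ^ 2) := by
  rw [norm_smul, mul_pow, Complex.norm_real, Real.norm_eq_abs, sq_abs, Real.sq_sqrt ha,
    ENNReal.ofReal_mul ha]

theorem hasSum_wot_iff {t : ι → H →WOT[ℂ] G} {Z : H →WOT[ℂ] G} [CompleteSpace G] :
    HasSum t Z ↔ ∀ u v, HasSum (fun i => inner ℂ u (t i v)) (inner ℂ u (Z v)) := by
  have hsum : ∀ (s : Finset ι) (v : H), (∑ i ∈ s, t i) v = ∑ i ∈ s, t i v := fun s v => by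
    classical
    induction s using Finset.induction_on with
    | empty => simp
    | insert a s ha ih => simp [Finset.sum_insert ha, ih]
  rw [HasSum, ContinuousLinearMapWOT.tendsto_iff_forall_inner_apply_tendsto, forall_comm]
  simp only [hsum, inner_sum]
  rfl

theorem summable_wot_of_inner_eq [CompleteSpace H] [CompleteSpace G] {t : ι → H →WOT[ℂ] H}
    (V V' : H →L[ℂ] lp (fun _ : ι => G) 2)
    (ht : ∀ i u v, inner ℂ u (t i v) = inner ℂ (V u i) (V' v i)) : Summable t := by
  refine ⟨ContinuousLinearMapWOT.ofCLM (adjoint V ∘L V'), hasSum_wot_iff.mpr fun u v => ?_⟩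
  rw [show inner ℂ u (ContinuousLinearMapWOT.ofCLM (adjoint V ∘L V') v) = inner ℂ (V u) (V' v) from
    V.adjoint_inner_right u (V' v)]
  exact (lp.hasSum_inner (V u) (V' v)).congr_fun fun i => ht i u v

end Columns

/-! ### Quadratic forms of positive operators -/

section Forms

variable {H : Type*} [NormedAddCommGroup H] [InnerProductSpace ℂ H]

/-- The quadratic form `h ↦ ⟨h, A h⟩` of a positive operator, with values in `[0, ∞]` so that it
can be fed to `wordForm`. -/
noncomputable def form (A : H →L[ℂ] H) (h : H) : ℝ≥0∞ :=
  ENNReal.ofReal (RCLike.re (inner ℂ h (A h)))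

theorem form_one : form (1 : H →L[ℂ] H) = fun h => ENNReal.ofReal (‖h‖ ^ 2) := by
  funext h
  rw [form, one_apply_eq_self, inner_self_eq_norm_sq]

theorem re_inner_nonneg {A : H →L[ℂ] H} (hA : 0 ≤ A) (x : H) :
    0 ≤ RCLike.re (inner ℂ x (A x)) :=
  (A.nonneg_iff_isPositive.mp hA).re_inner_nonneg_right x

theorem inner_eq_re {A : H →L[ℂ] H} (hA : 0 ≤ A) (x : H) :
    inner ℂ x (A x) = ((RCLike.re (inner ℂ x (A x)) : ℝ) : ℂ) :=
  ((A.nonneg_iff_isPositive.mp hA).isSymmetric.coe_re_inner_self_apply x).symm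

theorem re_inner_mono {A B : H →L[ℂ] H} (hAB : A ≤ B) (x : H) :
    RCLike.re (inner ℂ x (A x)) ≤ RCLike.re (inner ℂ x (B x)) := by
  rw [← sub_nonneg, ← map_sub, ← inner_sub_right, ← sub_apply]
  exact (ContinuousLinearMap.le_def A B |>.mp hAB).re_inner_nonneg_right x

theorem nonneg_of_inner_eq_re {A : H →L[ℂ] H}
    (hA : ∀ x, ∃ r : ℝ, 0 ≤ r ∧ inner ℂ x (A x) = (r : ℂ)) : 0 ≤ A := by
  rw [A.nonneg_iff_isPositive, A.isPositive_iff_complex]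
  intro x
  obtain ⟨r, hr, hx⟩ := hA x
  rw [← inner_conj_symm, hx, Complex.conj_ofReal]
  exact ⟨by simp, by simpa using hr⟩

theorem form_add {A B : H →L[ℂ] H} (hA : 0 ≤ A) (hB : 0 ≤ B) (h : H) :
    form (A + B) h = form A h + form B h := by
  rw [form, add_apply, inner_add_right, map_add,
    ENNReal.ofReal_add (re_inner_nonneg hA h) (re_inner_nonneg hB h)]
  rfl

theorem form_mono {A B : H →L[ℂ] H} (hAB : A ≤ B) : form A ≤ form B := fun h =>
  ENNReal.ofReal_le_ofReal (re_inner_mono hAB h)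

theorem eq_of_form_eq {A B : H →L[ℂ] H} (hA : 0 ≤ A) (hB : 0 ≤ B) (h : form A = form B) :
    A = B := by
  refine ContinuousLinearMap.coe_injective ((ext_inner_map _ _).mp fun x => ?_)
  have hre := congrFun h x
  rw [form, form, ENNReal.ofReal_eq_ofReal_iff (re_inner_nonneg hA x) (re_inner_nonneg hB x)]
    at hre
  have hx : inner ℂ x (A x) = inner ℂ x (B x) := by rw [inner_eq_re hA, hre, ← inner_eq_re hB]
  change inner ℂ (A x) x = inner ℂ (B x) x
  rw [← inner_conj_symm, hx, inner_conj_symm]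

theorem form_sum [CompleteSpace H] {ι : Type*} (s : Finset ι) {A : ι → H →L[ℂ] H}
    (hA : ∀ i, 0 ≤ A i) (h : H) :
    form (∑ i ∈ s, A i) h = ∑ i ∈ s, form (A i) h := by
  classical
  induction s using Finset.induction_on with
  | empty => simp [form]
  | insert a s ha ih =>
    rw [Finset.sum_insert ha, Finset.sum_insert ha,
      form_add (hA a) (Finset.sum_nonneg fun i _ => hA i), ih]

end Forms

/-! ### The maps `Φ_{f,X}` -/

section Phi

variable {H : Type*} [NormedAddCommGroup H] [InnerProductSpace ℂ H] [CompleteSpace H]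
variable {N : ℕ} {f : PosRegular N} {X : Fin N → (H →L[ℂ] H)}

theorem inner_phiTerm (Y : H →L[ℂ] H) (α : FreeMonoid (Fin N)) (u v : H) :
    inner ℂ u (phiTerm f X Y α v) = (f.coeff α : ℂ) *
      inner ℂ (adjoint (wordOp X α) u) (Y (adjoint (wordOp X α) v)) := by
  rw [show phiTerm f X Y α v = (f.coeff α : ℂ) • wordOp X α (Y (adjoint (wordOp X α) v)) from rfl,
    inner_smul_right, ContinuousLinearMap.adjoint_inner_left]

/-- Once the column with entries `√a_α X_α^*` is bounded, so is the column with entries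
`√a_α Y X_α^*`, and the series for `Φ_{f,X}(Y)` is the product of a row and a column. -/
theorem summable_phiTerm_of_bound {C : ℝ} (hC : 0 ≤ C)
    (hb : ∀ h, wordForm (ecoeff f) X (form 1) h ≤ ENNReal.ofReal (C * ‖h‖ ^ 2)) (Y : H →L[ℂ] H) :
    Summable (phiTerm f X Y) := by
  let B : FreeMonoid (Fin N) → H →L[ℂ] H := fun α =>
    ((√(f.coeff α) : ℝ) : ℂ) • adjoint (wordOp X α)
  have hB : ∀ h, ∑' α, ENNReal.ofReal (‖B α h‖ ^ 2) ≤ ENNReal.ofReal (C * ‖h‖ ^ 2) := fun h => by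
    refine le_of_eq_of_le (tsum_congr fun α => ?_) (hb h)
    rw [form_one]
    exact ofReal_norm_sqrt_smul_sq (f.coeff_nonneg α) _
  have hYB : ∀ h, ∑' α, ENNReal.ofReal (‖(Y ∘L B α) h‖ ^ 2) ≤
      ENNReal.ofReal (‖Y‖ ^ 2 * C * ‖h‖ ^ 2) := fun h => by
    rw [mul_assoc, ENNReal.ofReal_mul (by positivity)]
    refine le_trans ?_ (mul_le_mul_right (hB h) _)
    rw [← ENNReal.tsum_mul_left]
    refine ENNReal.tsum_le_tsum fun α => ?_
    rw [← ENNReal.ofReal_mul (by positivity), ← mul_pow]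
    exact ENNReal.ofReal_le_ofReal (pow_le_pow_left₀ (norm_nonneg _) (Y.le_opNorm _) 2)
  obtain ⟨V, hV⟩ := exists_column B hC hB
  obtain ⟨V', hV'⟩ := exists_column (fun α => Y ∘L B α) (by positivity) hYB
  refine summable_wot_of_inner_eq V V' fun α u v => ?_
  rw [inner_phiTerm, hV, hV', show inner ℂ (B α u) ((Y ∘L B α) v) =
    inner ℂ (((√(f.coeff α) : ℝ) : ℂ) • adjoint (wordOp X α) u)
      (Y (((√(f.coeff α) : ℝ) : ℂ) • adjoint (wordOp X α) v)) from rfl, map_smul, inner_smul_left,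
    inner_smul_right, Complex.conj_ofReal, ← mul_assoc, ← Complex.ofReal_mul,
    Real.mul_self_sqrt (f.coeff_nonneg α)]

theorem hasSum_inner_phi {Y : H →L[ℂ] H} (hX : Summable (phiTerm f X Y)) (u v : H) :
    HasSum (fun α => (f.coeff α : ℂ) *
      inner ℂ (adjoint (wordOp X α) u) (Y (adjoint (wordOp X α) v))) (inner ℂ u (phi f X Y v)) := by
  have hsum := hasSum_wot_iff.mp hX.hasSum u v
  simp only [inner_phiTerm] at hsum
  exact hsum

theorem hasSum_re_inner_phi {Y : H →L[ℂ] H} (hX : Summable (phiTerm f X Y)) (u : H) :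
    HasSum (fun α => f.coeff α *
      RCLike.re (inner ℂ (adjoint (wordOp X α) u) (Y (adjoint (wordOp X α) u))))
      (RCLike.re (inner ℂ u (phi f X Y u))) := by
  simpa [Function.comp_def] using Complex.reCLM.hasSum (hasSum_inner_phi hX u u)

theorem phi_nonneg {Y : H →L[ℂ] H} (hX : Summable (phiTerm f X Y)) (hY : 0 ≤ Y) :
    0 ≤ phi f X Y := by
  refine nonneg_of_inner_eq_re fun u => ⟨RCLike.re (inner ℂ u (phi f X Y u)), ?_, ?_⟩
  · exact (hasSum_re_inner_phi hX u).nonneg fun α =>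
      mul_nonneg (f.coeff_nonneg α) (re_inner_nonneg hY _)
  · refine (hasSum_inner_phi hX u u).unique ?_
    refine (Complex.ofRealCLM.hasSum (hasSum_re_inner_phi hX u)).congr_fun fun α => ?_
    rw [inner_eq_re hY]
    simp

theorem form_phi {Y : H →L[ℂ] H} (hX : Summable (phiTerm f X Y)) (hY : 0 ≤ Y) :
    form (phi f X Y) = wordForm (ecoeff f) X (form Y) := by
  funext u
  have hsum := hasSum_re_inner_phi hX u
  rw [form, ← hsum.tsum_eq, ENNReal.ofReal_tsum_of_nonneg (fun α =>
    mul_nonneg (f.coeff_nonneg α) (re_inner_nonneg hY _)) hsum.summable]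
  simp only [ENNReal.ofReal_mul (f.coeff_nonneg _)]
  rfl

theorem summable_phiTerm (hX : Summable (phiTerm f X 1)) (Y : H →L[ℂ] H) :
    Summable (phiTerm f X Y) := by
  refine summable_phiTerm_of_bound (norm_nonneg (phi f X 1)) (fun h => ?_) Y
  rw [← form_phi hX zero_le_one]
  refine ENNReal.ofReal_le_ofReal ?_
  calc RCLike.re (inner ℂ h (phi f X 1 h)) ≤ ‖h‖ * ‖phi f X 1 h‖ :=
        (Complex.re_le_norm _).trans (norm_inner_le_norm _ _)
    _ ≤ ‖h‖ * (‖phi f X 1‖ * ‖h‖) := by gcongr; exact (phi f X 1).le_opNorm h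
    _ = ‖phi f X 1‖ * ‖h‖ ^ 2 := by ring

/-- The map `Φ_{f,X}` as a linear endomorphism of the space of bounded operators. -/
noncomputable def phiEnd (hX : Summable (phiTerm f X 1)) : Module.End ℂ (H →L[ℂ] H) where
  toFun := phi f X
  map_add' Y Z := by
    have hterm : phiTerm f X (Y + Z) = fun α => phiTerm f X Y α + phiTerm f X Z α := by
      funext α
      simp only [phiTerm, ContinuousLinearMap.add_comp, ContinuousLinearMap.comp_add, smul_add,
        ContinuousLinearMapWOT.ofCLM_add]
    rw [phi, hterm, (summable_phiTerm hX Y).tsum_add (summable_phiTerm hX Z),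
      ContinuousLinearMapWOT.toCLM_add]
    rfl
  map_smul' c Y := by
    have hterm : phiTerm f X (c • Y) = fun α => c • phiTerm f X Y α := by
      funext α
      simp only [phiTerm, ContinuousLinearMap.smul_comp, ContinuousLinearMap.comp_smul,
        ContinuousLinearMapWOT.ofCLM_smul, smul_comm c]
    rw [phi, hterm, (summable_phiTerm hX Y).tsum_const_smul c, ContinuousLinearMapWOT.toCLM_smul]
    rfl

theorem phiEnd_nonneg (hX : Summable (phiTerm f X 1)) {Y : H →L[ℂ] H} (hY : 0 ≤ Y) :
    0 ≤ phiEnd hX Y :=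
  phi_nonneg (summable_phiTerm hX Y) hY

theorem form_phiEnd (hX : Summable (phiTerm f X 1)) {Y : H →L[ℂ] H} (hY : 0 ≤ Y) :
    form (phiEnd hX Y) = wordForm (ecoeff f) X (form Y) :=
  form_phi (summable_phiTerm hX Y) hY

theorem phiEnd_commute {M : ℕ} {g : PosRegular M} {Z : Fin M → (H →L[ℂ] H)}
    (h : ∀ a b, Commute (X a) (Z b)) (hX : Summable (phiTerm f X 1))
    (hZ : Summable (phiTerm g Z 1)) : Commute (phiEnd hX) (phiEnd hZ) := by
  refine LinearMap.ext_on CStarAlgebra.span_nonneg fun Y hY => ?_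
  simp only [Module.End.mul_apply]
  refine eq_of_form_eq (phiEnd_nonneg hX (phiEnd_nonneg hZ hY))
    (phiEnd_nonneg hZ (phiEnd_nonneg hX hY)) ?_
  rw [form_phiEnd hX (phiEnd_nonneg hZ hY), form_phiEnd hZ hY,
    form_phiEnd hZ (phiEnd_nonneg hX hY), form_phiEnd hX hY, wordForm_comm _ _ h]

end Phi

/-! ### Positive contractions -/

section PositiveContractions

theorem sum_pow_apply_one_sub {R V : Type*} [Ring R] [AddCommGroup V] [Module R V]
    (Φ : Module.End R V) (Y : V) (N : ℕ) :
    ∑ p ∈ Finset.range N, (Φ ^ p) ((1 - Φ) Y) = (1 - Φ ^ N) Y := by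
  rw [← geom_sum_mul_neg, Module.End.mul_apply, LinearMap.sum_apply]

variable {A : Type*} [CStarAlgebra A] [PartialOrder A]

/-- Positive linear maps `Φ` on a unital C⋆-algebra with `Φ(1) ≤ 1`. -/
structure IsPosContr (Φ : Module.End ℂ A) : Prop where
  nonneg : ∀ Y, 0 ≤ Y → 0 ≤ Φ Y
  one_le : Φ 1 ≤ 1

variable [StarOrderedRing A]

theorem nonneg_of_forall_neg_le_nsmul {c D : A} (h : ∀ N : ℕ, -c ≤ N • D) : 0 ≤ D := by
  have hlim : Filter.Tendsto (fun N : ℕ => -((1 / ((N : ℝ) + 1)) • c)) Filter.atTop (nhds 0) := by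
    simpa using ((tendsto_one_div_add_atTop_nhds_zero_nat (𝕜 := ℝ)).smul_const c).neg
  refine le_of_tendsto' hlim fun N => ?_
  have hN : (0 : ℝ) < (N : ℝ) + 1 := by positivity
  have hsmul := smul_le_smul_of_nonneg_left (h (N + 1)) (one_div_pos.mpr hN).le
  rwa [← Nat.cast_smul_eq_nsmul ℝ, smul_smul, Nat.cast_add_one, one_div_mul_cancel hN.ne',
    one_smul, smul_neg] at hsmul

namespace IsPosContr

variable {Φ : Module.End ℂ A} (hΦ : IsPosContr Φ)
include hΦ

theorem mono : Monotone Φ := fun Y Z h => by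
  rw [← sub_nonneg, ← map_sub]
  exact hΦ.nonneg _ (sub_nonneg.mpr h)

theorem pow (p : ℕ) : IsPosContr (Φ ^ p) := by
  induction p with
  | zero => exact ⟨fun _ hY => hY, le_rfl⟩
  | succ p ih =>
    rw [pow_succ']
    exact ⟨fun Y hY => hΦ.nonneg _ (ih.nonneg Y hY), (hΦ.mono ih.one_le).trans hΦ.one_le⟩

theorem apply_le_algebraMap {Y : A} {c : ℝ} (hc : 0 ≤ c) (h : Y ≤ algebraMap ℝ A c) :
    Φ Y ≤ algebraMap ℝ A c := by
  refine (hΦ.mono h).trans ?_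
  rw [Algebra.algebraMap_eq_smul_one, LinearMap.map_smul_of_tower]
  exact smul_le_smul_of_nonneg_left hΦ.one_le hc

theorem isSelfAdjoint {Y : A} (hY : IsSelfAdjoint Y) : IsSelfAdjoint (Φ Y) := by
  have hc : 0 ≤ algebraMap ℝ A ‖Y‖ := algebraMap_nonneg A (norm_nonneg Y)
  have hΦY := (IsSelfAdjoint.of_nonneg (hΦ.nonneg _ hc)).sub
    (IsSelfAdjoint.of_nonneg (hΦ.nonneg _ (sub_nonneg.mpr hY.le_algebraMap_norm_self)))
  rwa [← map_sub, sub_sub_cancel] at hΦY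

theorem isSelfAdjoint_one_sub_pow {Y : A} (hY : IsSelfAdjoint Y) (p : ℕ) :
    IsSelfAdjoint (((1 - Φ) ^ p) Y) := by
  induction p with
  | zero => exact hY
  | succ p ih => rw [pow_succ']; exact ih.sub (hΦ.isSelfAdjoint ih)

theorem one_sub_apply_le {Y : A} (hY : IsSelfAdjoint Y) :
    (1 - Φ) Y ≤ algebraMap ℝ A (2 * ‖Y‖) := by
  have hneg : -Y ≤ algebraMap ℝ A ‖Y‖ := by simpa using hY.neg.le_algebraMap_norm_self
  have hΦY := hΦ.apply_le_algebraMap (norm_nonneg Y) hneg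
  rw [two_mul, map_add, LinearMap.sub_apply, sub_eq_add_neg, ← map_neg]
  exact add_le_add hY.le_algebraMap_norm_self hΦY

theorem neg_le_one_sub_apply {Y : A} (hY : IsSelfAdjoint Y) :
    -algebraMap ℝ A (2 * ‖Y‖) ≤ (1 - Φ) Y := by
  have h := hΦ.one_sub_apply_le hY.neg
  rwa [map_neg, norm_neg, neg_le] at h

theorem pow_le_self {Y : A} (h : 0 ≤ (1 - Φ) Y) (p : ℕ) : (Φ ^ p) Y ≤ Y := by
  rw [LinearMap.sub_apply, Module.End.one_apply, sub_nonneg] at h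
  induction p with
  | zero => exact le_rfl
  | succ p ih =>
    rw [pow_succ']
    exact (hΦ.mono ih).trans h

/-- The iterates `Φ^p D` of `D = (1 - Φ) Y` decrease while their partial sums are bounded, so that
`D` is at least `O(1 / N)` for all `N`. -/
theorem nonneg_one_sub_of_sq {Y : A} (hY : IsSelfAdjoint Y)
    (h : 0 ≤ (1 - Φ) ((1 - Φ) Y)) : 0 ≤ (1 - Φ) Y := by
  refine nonneg_of_forall_neg_le_nsmul (c := algebraMap ℝ A (2 * ‖Y‖)) fun N => ?_
  calc -algebraMap ℝ A (2 * ‖Y‖) ≤ (1 - Φ ^ N) Y := (hΦ.pow N).neg_le_one_sub_apply hY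
    _ = ∑ p ∈ Finset.range N, (Φ ^ p) ((1 - Φ) Y) := (sum_pow_apply_one_sub Φ Y N).symm
    _ ≤ ∑ _p ∈ Finset.range N, (1 - Φ) Y := Finset.sum_le_sum fun p _ => hΦ.pow_le_self h p
    _ = N • (1 - Φ) Y := by rw [Finset.sum_const, Finset.card_range]

theorem nonneg_one_sub_pow {Y : A} (hY : IsSelfAdjoint Y) {s d : ℕ} (hs : 1 ≤ s)
    (h : 0 ≤ ((1 - Φ) ^ (s + d)) Y) : 0 ≤ ((1 - Φ) ^ s) Y := by
  obtain ⟨s, rfl⟩ := Nat.exists_eq_add_of_le' hs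
  induction d with
  | zero => exact h
  | succ d ih =>
    refine ih ?_
    rw [add_right_comm, pow_succ', Module.End.mul_apply]
    refine hΦ.nonneg_one_sub_of_sq (hΦ.isSelfAdjoint_one_sub_pow hY _) ?_
    rwa [show s + 1 + (d + 1) = s + d + 1 + 1 by ring, pow_succ', pow_succ'] at h

end IsPosContr

end PositiveContractions

/-! ### Geometric series of positive contractions -/

section GeometricSeries

variable {H : Type*} [NormedAddCommGroup H] [InnerProductSpace ℂ H] [CompleteSpace H]
variable {N : ℕ} {f : PosRegular N} {X : Fin N → (H →L[ℂ] H)} (hX : Summable (phiTerm f X 1))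

theorem form_phiEnd_pow {Y : H →L[ℂ] H} (hY : 0 ≤ Y) (p : ℕ) :
    0 ≤ (phiEnd hX ^ p) Y ∧ form ((phiEnd hX ^ p) Y) = (wordForm (ecoeff f) X)^[p] (form Y) := by
  induction p with
  | zero => exact ⟨hY, rfl⟩
  | succ p ih =>
    rw [pow_succ', Module.End.mul_apply, form_phiEnd hX ih.1, ih.2, Function.iterate_succ_apply']
    exact ⟨phiEnd_nonneg hX ih.1, rfl⟩

theorem geomForm_form_one_sub {Z : H →L[ℂ] H} (hZ : 0 ≤ (1 - phiEnd hX) Z) :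
    geomForm (ecoeff f) X (form ((1 - phiEnd hX) Z)) =
      fun h => ⨆ M : ℕ, form ((1 - phiEnd hX ^ M) Z) h := by
  funext h
  rw [geomForm, ENNReal.tsum_eq_iSup_nat]
  refine iSup_congr fun M => ?_
  rw [← sum_pow_apply_one_sub, form_sum _ fun p => (form_phiEnd_pow hX hZ p).1]
  exact Finset.sum_congr rfl fun p _ => congrFun (form_phiEnd_pow hX hZ p).2.symm h

variable {hX} (hΦ : IsPosContr (phiEnd hX)) {Z : H →L[ℂ] H} (hZ : IsSelfAdjoint Z)
include hΦ hZ

theorem tendsto_form_phiEnd_pow (h0 : 0 ≤ (1 - phiEnd hX) Z) (x : H) :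
    Filter.Tendsto (fun M : ℕ => form ((phiEnd hX ^ M) ((1 - phiEnd hX) Z)) x) Filter.atTop
      (nhds 0) := by
  simp only [(form_phiEnd_pow hX h0 _).2]
  refine ENNReal.tendsto_atTop_zero_of_tsum_ne_top (ne_top_of_le_ne_top ?_
    ((congrFun (geomForm_form_one_sub hX h0) x).trans_le (iSup_le fun M =>
      form_mono ((hΦ.pow M).one_sub_apply_le hZ) x)))
  exact ENNReal.ofReal_ne_top

theorem geomForm_form_one_sub_sq (h0 : 0 ≤ (1 - phiEnd hX) ((1 - phiEnd hX) Z)) :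
    geomForm (ecoeff f) X (form ((1 - phiEnd hX) ((1 - phiEnd hX) Z))) =
      form ((1 - phiEnd hX) Z) := by
  have hD := hΦ.nonneg_one_sub_of_sq hZ h0
  rw [geomForm_form_one_sub hX h0]
  funext x
  refine le_antisymm (iSup_le fun M => form_mono ?_ x) ?_
  · exact sub_le_self _ ((hΦ.pow M).nonneg _ hD)
  · have hlim := (tendsto_form_phiEnd_pow hΦ hZ hD x).const_add
      (⨆ M : ℕ, form ((1 - phiEnd hX ^ M) ((1 - phiEnd hX) Z)) x)
    rw [add_zero] at hlim
    refine ge_of_tendsto' hlim fun M => ?_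
    have hM : 0 ≤ (1 - phiEnd hX ^ M) ((1 - phiEnd hX) Z) :=
      sub_nonneg.mpr (hΦ.pow_le_self h0 M)
    calc form ((1 - phiEnd hX) Z) x
        = form ((1 - phiEnd hX ^ M) ((1 - phiEnd hX) Z) +
            (phiEnd hX ^ M) ((1 - phiEnd hX) Z)) x := by
          rw [← LinearMap.add_apply, sub_add_cancel, Module.End.one_apply]
      _ ≤ _ := by
          rw [form_add hM ((hΦ.pow M).nonneg _ hD)]
          exact add_le_add_left (le_iSup (fun M : ℕ =>
            form ((1 - phiEnd hX ^ M) ((1 - phiEnd hX) Z)) x) M) _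

theorem geomForm_iterate_form {m : ℕ} (hm : 1 ≤ m) (h0 : 0 ≤ ((1 - phiEnd hX) ^ m) Z) :
    (geomForm (ecoeff f) X)^[m] (form (((1 - phiEnd hX) ^ m) Z)) =
      fun h => ⨆ M : ℕ, form ((1 - phiEnd hX ^ M) Z) h := by
  induction m, hm using Nat.le_induction with
  | base => exact geomForm_form_one_sub hX (by simpa using h0)
  | succ m hm ih =>
    have hpow := hΦ.nonneg_one_sub_pow hZ hm h0
    obtain ⟨s, rfl⟩ := Nat.exists_eq_add_of_le' hm
    rw [← ih hpow, Function.iterate_succ_apply]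
    rw [pow_succ', Module.End.mul_apply, pow_succ', Module.End.mul_apply] at h0 ⊢
    rw [geomForm_form_one_sub_sq hΦ (hΦ.isSelfAdjoint_one_sub_pow hZ s) h0]

end GeometricSeries

/-! ### Commuting families of positive contractions -/

section Products

variable {ι R : Type*} [Ring R] (φ : ι → R)

/-- The product `∏_{i ∈ l} (1 - φ_i)^{p_i}`, which is the map `Δ^p` if `φ_i = Φ_{f_i,X_i}`. -/
def defectProd (p : ι → ℕ) (l : List ι) : R := (l.map fun i => (1 - φ i) ^ p i).prod

/-- The product `∏_{i ∈ l} (1 - φ_i^{q_i})`, whose limit as `q → ∞` decides purity. -/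
def netProd (q : ι → ℕ) (l : List ι) : R := (l.map fun i => 1 - φ i ^ q i).prod

variable {φ}

theorem defectProd_cons (p : ι → ℕ) (i : ι) (l : List ι) :
    defectProd φ p (i :: l) = (1 - φ i) ^ p i * defectProd φ p l := by
  rw [defectProd, List.map_cons, List.prod_cons, defectProd]

theorem netProd_cons (q : ι → ℕ) (i : ι) (l : List ι) :
    netProd φ q (i :: l) = (1 - φ i ^ q i) * netProd φ q l := by
  rw [netProd, List.map_cons, List.prod_cons, netProd]

theorem commute_defectProd {a : R} (h : ∀ i, Commute a (φ i)) (p : ι → ℕ) (l : List ι) :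
    Commute a (defectProd φ p l) :=
  Commute.list_prod_right _ _ <| List.forall_mem_map.mpr fun i _ =>
    ((Commute.one_right a).sub_right (h i)).pow_right (p i)

theorem commute_netProd {a : R} (h : ∀ i, Commute a (φ i)) (q : ι → ℕ) (l : List ι) :
    Commute a (netProd φ q l) :=
  Commute.list_prod_right _ _ <| List.forall_mem_map.mpr fun i _ =>
    (Commute.one_right a).sub_right ((h i).pow_right (q i))

theorem commute_one_sub_pow_defectProd (hc : ∀ i j, Commute (φ i) (φ j)) (i : ι) (M : ℕ)
    (p : ι → ℕ) (l : List ι) : Commute (1 - φ i ^ M) (defectProd φ p l) :=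
  (Commute.one_left _).sub_left ((commute_defectProd (hc i) p l).pow_left M)

theorem commute_one_sub_pow_netProd (hc : ∀ i j, Commute (φ i) (φ j)) (i : ι) (M : ℕ)
    (q : ι → ℕ) (l : List ι) : Commute (1 - φ i ^ M) (netProd φ q l) :=
  (Commute.one_left _).sub_left ((commute_netProd (hc i) q l).pow_left M)

theorem netProd_congr {q q' : ι → ℕ} {l : List ι} (h : ∀ i ∈ l, q i = q' i) :
    netProd φ q l = netProd φ q' l :=
  congrArg List.prod (List.map_congr_left fun i hi => by rw [h i hi])

theorem netProd_reverse (hc : ∀ i j, Commute (φ i) (φ j)) (q : ι → ℕ) (l : List ι) :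
    netProd φ q l.reverse = netProd φ q l := by
  refine ((List.reverse_perm l).map _).prod_eq' ?_
  refine List.pairwise_map.mpr (List.pairwise_of_forall fun i j => ?_)
  exact (Commute.one_right _).sub_right
    ((Commute.one_left _).sub_left ((hc i j).pow_pow (q i) (q j)))

theorem defectProd_ite_mem [DecidableEq ι] {l s : List ι} (hl : l.Nodup) (hs : s.Sublist l)
    (p : ι → ℕ) :
    defectProd φ (fun i => (if i ∈ s then 1 else 0) * p i) l = defectProd φ p s := by
  induction hs with
  | slnil => rfl
  | @cons s l i hs ih =>
    have hi : i ∉ s := fun h => (List.nodup_cons.mp hl).1 (hs.subset h)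
    rw [defectProd_cons, ih (List.nodup_cons.mp hl).2, if_neg hi, zero_mul, pow_zero, one_mul]
  | @cons_cons s l i _ ih =>
    obtain ⟨hi, hl⟩ := List.nodup_cons.mp hl
    rw [defectProd_cons, defectProd_cons, ← ih hl, if_pos List.mem_cons_self, one_mul]
    refine congrArg _ (congrArg List.prod (List.map_congr_left fun j hj => ?_))
    have hji : j ≠ i := fun h => hi (h ▸ hj)
    simp only [List.mem_cons, hji, false_or]

end Products

section CommutingFamilies

variable {ι A : Type*} [CStarAlgebra A] [PartialOrder A]

/-- Positivity of all the defects `∏_{i ∈ l} (1 - Φ_i)^{ε_i m_i} Z`, `ε_i ∈ {0, 1}`; the choice of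
`ε` is encoded as the sublist of `l` on which it equals `1`. -/
def DefectsNonneg (Φ : ι → Module.End ℂ A) (m : ι → ℕ) (l : List ι) (Z : A) : Prop :=
  ∀ s, s.Sublist l → 0 ≤ defectProd Φ m s Z

namespace DefectsNonneg

variable {Φ : ι → Module.End ℂ A} {m : ι → ℕ} {l : List ι} {i : ι} {Z : A}

theorem nonneg (h : DefectsNonneg Φ m l Z) : 0 ≤ Z := h [] (List.nil_sublist l)

theorem of_cons (h : DefectsNonneg Φ m (i :: l) Z) : DefectsNonneg Φ m l Z :=
  fun s hs => h s (hs.cons i)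

variable [StarOrderedRing A] (hc : ∀ i j, Commute (Φ i) (Φ j)) (hΦ : ∀ i, IsPosContr (Φ i))

theorem sum {κ : Type*} (t : Finset κ) {Z : κ → A} (h : ∀ j, DefectsNonneg Φ m l (Z j)) :
    DefectsNonneg Φ m l (∑ j ∈ t, Z j) := fun s hs => by
  rw [map_sum]
  exact Finset.sum_nonneg fun j _ => h j s hs

include hc hΦ

theorem map_pow (h : DefectsNonneg Φ m l Z) (i : ι) (p : ℕ) :
    DefectsNonneg Φ m l ((Φ i ^ p) Z) := fun s hs => by
  rw [← Module.End.mul_apply, ← ((commute_defectProd (hc i) m s).pow_left p).eq]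
  exact ((hΦ i).pow p).nonneg _ (h s hs)

theorem one_sub (hi : 1 ≤ m i) (h : DefectsNonneg Φ m (i :: l) Z) :
    DefectsNonneg Φ m l ((1 - Φ i) Z) := fun s hs => by
  have hcomm := commute_one_sub_pow_defectProd hc i 1 m s
  rw [pow_one] at hcomm
  rw [← Module.End.mul_apply, ← hcomm.eq, Module.End.mul_apply, ← pow_one (1 - Φ i)]
  refine (hΦ i).nonneg_one_sub_pow (IsSelfAdjoint.of_nonneg (h.of_cons s hs)) le_rfl
    (d := m i - 1) ?_
  rw [Nat.add_sub_cancel' hi, ← Module.End.mul_apply, ← defectProd_cons]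
  exact h _ (hs.cons_cons i)

theorem one_sub_pow (hi : 1 ≤ m i) (h : DefectsNonneg Φ m (i :: l) Z) (p : ℕ) :
    DefectsNonneg Φ m l ((1 - Φ i ^ p) Z) := by
  rw [← sum_pow_apply_one_sub]
  exact sum _ fun j => map_pow hc hΦ (one_sub hc hΦ hi h) i j

theorem pow_sub_pow (hi : 1 ≤ m i) (h : DefectsNonneg Φ m (i :: l) Z) {a b : ℕ} (hab : a ≤ b) :
    DefectsNonneg Φ m l ((1 - Φ i ^ b) Z - (1 - Φ i ^ a) Z) := by
  obtain ⟨c, rfl⟩ := Nat.exists_eq_add_of_le hab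
  have hsub : (1 - Φ i ^ (a + c)) Z - (1 - Φ i ^ a) Z = (Φ i ^ a) ((1 - Φ i ^ c) Z) := by
    rw [← LinearMap.sub_apply, ← Module.End.mul_apply, mul_sub, ← pow_add, mul_one,
      sub_sub_sub_cancel_left]
  rw [hsub]
  exact map_pow hc hΦ (one_sub_pow hc hΦ hi h c) i a

theorem defectProd_one_sub_pow_mono (hi : 1 ≤ m i) (h : DefectsNonneg Φ m (i :: l) Z) :
    Monotone fun M : ℕ => defectProd Φ m l ((1 - Φ i ^ M) Z) := fun a b hab => by
  rw [← sub_nonneg, ← map_sub]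
  exact pow_sub_pow hc hΦ hi h hab l (List.Sublist.refl l)

variable (hm : ∀ i, 1 ≤ m i)
include hm

theorem netProd_nonneg (h : DefectsNonneg Φ m l Z) (q : ι → ℕ) : 0 ≤ netProd Φ q l Z := by
  induction l generalizing Z with
  | nil => exact h.nonneg
  | cons i l ih =>
    rw [netProd_cons, (commute_one_sub_pow_netProd hc i _ q l).eq]
    exact ih (one_sub_pow hc hΦ (hm i) h (q i))

theorem netProd_le (h : DefectsNonneg Φ m l Z) (q : ι → ℕ) : netProd Φ q l Z ≤ Z := by
  induction l with
  | nil => exact le_rfl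
  | cons i l ih =>
    rw [netProd_cons, Module.End.mul_apply, LinearMap.sub_apply, Module.End.one_apply]
    exact (sub_le_self _ (((hΦ i).pow (q i)).nonneg _ (netProd_nonneg hc hΦ hm h.of_cons q))).trans
      (ih h.of_cons)

theorem netProd_mono (h : DefectsNonneg Φ m l Z) : Monotone fun q => netProd Φ q l Z := by
  intro q q' hq
  induction l generalizing Z with
  | nil => exact le_rfl
  | cons i l ih =>
    simp only [netProd_cons, (commute_one_sub_pow_netProd hc i _ _ l).eq, Module.End.mul_apply]
    refine (ih (one_sub_pow hc hΦ (hm i) h (q i))).trans ?_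
    rw [← sub_nonneg, ← map_sub]
    exact netProd_nonneg hc hΦ hm (pow_sub_pow hc hΦ (hm i) h (hq i)) q'

end DefectsNonneg

end CommutingFamilies

/-! ### Iterated word forms -/

section WordForms

variable {H : Type*} [NormedAddCommGroup H] [InnerProductSpace ℂ H] [CompleteSpace H]

theorem tsum_iSup_of_monotone {ι : Type*} {g : ι → ℕ → ℝ≥0∞} (hg : ∀ i, Monotone (g i)) :
    ∑' i, ⨆ M, g i M = ⨆ M, ∑' i, g i M := by
  simp only [ENNReal.tsum_eq_iSup_sum]
  rw [iSup_comm]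
  exact iSup_congr fun s => ENNReal.finsetSum_iSup_of_monotone hg

theorem wordForm_iSup {N : ℕ} (c : FreeMonoid (Fin N) → ℝ≥0∞) (X : Fin N → (H →L[ℂ] H))
    {q : ℕ → H → ℝ≥0∞} (hq : Monotone q) :
    wordForm c X (fun h => ⨆ M, q M h) = fun h => ⨆ M, wordForm c X (q M) h := by
  funext h
  simp only [wordForm, ENNReal.mul_iSup]
  exact tsum_iSup_of_monotone fun α a b hab => mul_le_mul_right (hq hab _) _

variable {k : ℕ} {n : Fin k → ℕ} (c : ∀ i, FreeMonoid (Fin (n i)) → ℝ≥0∞) (X : OpTuple n H)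

/-- The composition of the maps `wordForm (c i) (X i)`, `i ∈ l`. -/
noncomputable def wordForms (l : List (Fin k)) (q : H → ℝ≥0∞) : H → ℝ≥0∞ :=
  l.foldl (fun q i => wordForm (c i) (X i) q) q

theorem wordForms_cons (i : Fin k) (l : List (Fin k)) (q : H → ℝ≥0∞) :
    wordForms c X (i :: l) q = wordForms c X l (wordForm (c i) (X i) q) :=
  rfl

theorem wordForms_mono (l : List (Fin k)) : Monotone (wordForms c X l) := by
  induction l with
  | nil => exact monotone_id
  | cons i l ih => exact ih.comp (wordForm_mono (c i) (X i))

theorem wordForms_iSup (l : List (Fin k)) {q : ℕ → H → ℝ≥0∞} (hq : Monotone q) :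
    wordForms c X l (fun h => ⨆ M, q M h) = fun h => ⨆ M, wordForms c X l (q M) h := by
  induction l generalizing q with
  | nil => rfl
  | cons i l ih =>
    simp only [wordForms_cons, wordForm_iSup (c i) (X i) hq]
    exact ih fun a b hab => wordForm_mono (c i) (X i) (hq hab)

end WordForms

/-! ### The polydomain -/

section MemPolydomain

variable {H : Type*} [NormedAddCommGroup H] [InnerProductSpace ℂ H] [CompleteSpace H]
variable {k : ℕ} {n : Fin k → ℕ} {f : ∀ i, PosRegular (n i)} {m : Fin k → ℕ} {X : OpTuple n H}

theorem list_prod_map_end_apply {ι R V : Type*} [Semiring R] [AddCommMonoid V] [Module R V]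
    (T : ι → Module.End R V) (l : List ι) (v : V) :
    (l.map T).prod v = l.foldr (fun i v => T i v) v := by
  induction l with
  | nil => rfl
  | cons i l ih => rw [List.map_cons, List.prod_cons, Module.End.mul_apply, ih, List.foldr_cons]

section DefectProd

variable (hX : ∀ i, Summable (phiTerm (f i) (X i) 1))

/-- The weights `b_{i,α}` are the coefficients of `(1 - f_i)^{-m_i}`, so one word form undoes the
factor `(1 - Φ_i)^{m_i}` of the defect, up to the error term `Φ_i^M` which is left of the geometric
series. -/
theorem wordForm_eweight_form_defectProd_cons
    (hc : ∀ i j, Commute (phiEnd (hX i)) (phiEnd (hX j)))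
    (hΦ : ∀ i, IsPosContr (phiEnd (hX i))) {i : Fin k} (hi : 1 ≤ m i) {l : List (Fin k)}
    {Z : H →L[ℂ] H} (hZ : DefectsNonneg (fun i => phiEnd (hX i)) m (i :: l) Z) :
    wordForm (eweight (f i) (m i)) (X i)
        (form (defectProd (fun i => phiEnd (hX i)) m (i :: l) Z)) =
      fun h => ⨆ M : ℕ,
        form (defectProd (fun i => phiEnd (hX i)) m l ((1 - phiEnd (hX i) ^ M) Z)) h := by
  have hl := hZ _ (List.Sublist.refl _)
  rw [defectProd_cons, Module.End.mul_apply] at hl ⊢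
  rw [wordForm_eweight _ _ hi, geomForm_iterate_form (hΦ i)
    (IsSelfAdjoint.of_nonneg (hZ.of_cons l (List.Sublist.refl l))) hi hl]
  simp only [← Module.End.mul_apply, (commute_one_sub_pow_defectProd hc i _ m l).eq]

theorem wordForms_eweight_form_defectProd (hc : ∀ i j, Commute (phiEnd (hX i)) (phiEnd (hX j)))
    (hΦ : ∀ i, IsPosContr (phiEnd (hX i))) (hm : ∀ i, 1 ≤ m i) {l : List (Fin k)} (hl : l.Nodup)
    {Z : H →L[ℂ] H} (hZ : DefectsNonneg (fun i => phiEnd (hX i)) m l Z) :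
    wordForms (fun i => eweight (f i) (m i)) X l
        (form (defectProd (fun i => phiEnd (hX i)) m l Z)) =
      fun h => ⨆ q, form (netProd (fun i => phiEnd (hX i)) q l Z) h := by
  induction l generalizing Z with
  | nil => exact funext fun h => (ciSup_const (ι := Fin k → ℕ) (a := form Z h)).symm
  | cons i l ih =>
    obtain ⟨hi, hl⟩ := List.nodup_cons.mp hl
    have hmono := DefectsNonneg.defectProd_one_sub_pow_mono hc hΦ (hm i) hZ
    rw [wordForms_cons, wordForm_eweight_form_defectProd_cons hX hc hΦ (hm i) hZ,
      wordForms_iSup _ _ _ fun a b hab => form_mono (hmono hab)]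
    funext h
    simp only [ih hl (hZ.one_sub_pow hc hΦ (hm i) _), netProd_cons,
      (commute_one_sub_pow_netProd hc i _ _ l).eq, Module.End.mul_apply]
    refine le_antisymm (iSup_le fun M => iSup_le fun q => ?_) (iSup_le fun q => ?_)
    · have hq : netProd (fun i => phiEnd (hX i)) (Function.update q i M) l =
          netProd (fun i => phiEnd (hX i)) q l :=
        netProd_congr fun j hj => Function.update_of_ne (ne_of_mem_of_not_mem hj hi) _ _
      refine le_iSup_of_le (Function.update q i M) (le_of_eq ?_)
      rw [Function.update_self, hq]
    · exact le_iSup_of_le (q i) (le_iSup_of_le q le_rfl)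

theorem defect_eq_defectProd (p : Fin k → ℕ) (Y : H →L[ℂ] H) :
    defect f X p Y = defectProd (fun i => phiEnd (hX i)) p (List.finRange k) Y := by
  rw [defectProd, list_prod_map_end_apply]
  refine List.foldr_ext _ _ _ fun i _ Z => ?_
  rw [Module.End.pow_apply]
  rfl

theorem cncNet_eq_netProd (q : Fin k → ℕ) :
    cncNet f X q = netProd (fun i => phiEnd (hX i)) q (List.finRange k) 1 := by
  rw [netProd, list_prod_map_end_apply]
  refine List.foldr_ext _ _ _ fun i _ Z => ?_
  rw [LinearMap.sub_apply, Module.End.one_apply, Module.End.pow_apply]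
  rfl

theorem pureNet_eq_netProd_reverse (q : Fin k → ℕ) :
    pureNet f X q = netProd (fun i => phiEnd (hX i)) q (List.finRange k).reverse 1 := by
  rw [netProd, list_prod_map_end_apply, pureNet, List.foldl_eq_foldr_reverse]
  refine List.foldr_ext _ _ _ fun i _ Z => ?_
  rw [LinearMap.sub_apply, Module.End.one_apply, Module.End.pow_apply]
  rfl

end DefectProd

namespace MemPolydomain

variable (hX : MemPolydomain f m X)
include hX

theorem commute_phiEnd (i j : Fin k) :
    Commute (phiEnd (hX.summable i)) (phiEnd (hX.summable j)) := by
  obtain rfl | h := eq_or_ne i j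
  · exact Commute.refl _
  · exact phiEnd_commute (hX.commute i j h) _ _

theorem isPosContr (i : Fin k) : IsPosContr (phiEnd (hX.summable i)) :=
  ⟨fun _ => phiEnd_nonneg _, hX.phi_le i⟩

theorem pureNet_eq_netProd (q : Fin k → ℕ) :
    pureNet f X q = netProd (fun i => phiEnd (hX.summable i)) q (List.finRange k) 1 := by
  rw [pureNet_eq_netProd_reverse hX.summable, netProd_reverse hX.commute_phiEnd]

theorem cncNet_eq_pureNet (q : Fin k → ℕ) : cncNet f X q = pureNet f X q := by
  rw [cncNet_eq_netProd hX.summable, hX.pureNet_eq_netProd]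

theorem defectsNonneg :
    DefectsNonneg (fun i => phiEnd (hX.summable i)) m (List.finRange k) 1 := fun s hs => by
  have h := hX.defect_nonneg (fun i => if i ∈ s then 1 else 0) fun i => (ite_eq_or_eq _ _ _).symm
  rwa [defect_eq_defectProd hX.summable, defectProd_ite_mem (List.nodup_finRange k) hs] at h

theorem defect_self_nonneg : 0 ≤ defect f X m 1 := by
  rw [defect_eq_defectProd hX.summable]
  exact hX.defectsNonneg _ (List.Sublist.refl _)

variable (hm : ∀ i, 1 ≤ m i)
include hm

theorem pureNet_nonneg (q : Fin k → ℕ) : 0 ≤ pureNet f X q := by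
  rw [hX.pureNet_eq_netProd]
  exact hX.defectsNonneg.netProd_nonneg hX.commute_phiEnd hX.isPosContr hm q

theorem pureNet_le_one (q : Fin k → ℕ) : pureNet f X q ≤ 1 := by
  rw [hX.pureNet_eq_netProd]
  exact hX.defectsNonneg.netProd_le hX.commute_phiEnd hX.isPosContr hm q

theorem pureNet_mono : Monotone (pureNet f X) := fun q q' hq => by
  rw [hX.pureNet_eq_netProd, hX.pureNet_eq_netProd]
  exact hX.defectsNonneg.netProd_mono hX.commute_phiEnd hX.isPosContr hm hq

theorem wordForms_form_defect :
    wordForms (fun i => eweight (f i) (m i)) X (List.finRange k) (form (defect f X m 1)) =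
      fun h => ⨆ q, form (pureNet f X q) h := by
  simp only [defect_eq_defectProd hX.summable, hX.pureNet_eq_netProd]
  exact wordForms_eweight_form_defectProd hX.summable hX.commute_phiEnd hX.isPosContr hm
    (List.nodup_finRange k) hX.defectsNonneg

end MemPolydomain

end MemPolydomain

/-! ### Square roots of positive operators -/

section SquareRoots

variable {H : Type*} [NormedAddCommGroup H] [InnerProductSpace ℂ H] [CompleteSpace H]

theorem adjoint_opSqrt (A : H →L[ℂ] H) : adjoint (opSqrt A) = opSqrt A :=
  ContinuousLinearMap.isSelfAdjoint_iff'.mp (IsSelfAdjoint.of_nonneg (CFC.sqrt_nonneg A))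

variable {A : H →L[ℂ] H} (hA : 0 ≤ A)
include hA

theorem opSqrt_comp_opSqrt : opSqrt A ∘L opSqrt A = A := CFC.sqrt_mul_sqrt_self A hA

theorem opSqrt_opSqrt_apply (x : H) : opSqrt A (opSqrt A x) = A x :=
  DFunLike.congr_fun (opSqrt_comp_opSqrt hA) x

theorem norm_opSqrt_apply_sq (x : H) : ‖opSqrt A x‖ ^ 2 = RCLike.re (inner ℂ x (A x)) := by
  rw [← inner_self_eq_norm_sq (𝕜 := ℂ), ← ContinuousLinearMap.adjoint_inner_right, adjoint_opSqrt,
    opSqrt_opSqrt_apply hA]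

theorem ofReal_norm_opSqrt_sq (x : H) : ENNReal.ofReal (‖opSqrt A x‖ ^ 2) = form A x := by
  rw [norm_opSqrt_apply_sq hA, form]

theorem opSqrt_apply_eq_zero {x : H} (hx : A x = 0) : opSqrt A x = 0 := by
  rw [← norm_eq_zero, ← sq_eq_zero_iff, norm_opSqrt_apply_sq hA, hx, inner_zero_right, map_zero]

theorem opSqrt_apply_mem (x : H) :
    opSqrt A x ∈ (LinearMap.range A.toLinearMap).topologicalClosure := by
  rw [← Submodule.orthogonal_orthogonal_eq_closure]
  intro z hz
  have hAz : A z = 0 := by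
    rwa [(A.nonneg_iff_isPositive.mp hA).isSymmetric.orthogonal_range] at hz
  rw [← ContinuousLinearMap.adjoint_inner_left, adjoint_opSqrt, opSqrt_apply_eq_zero hA hAz,
    inner_zero_left]

end SquareRoots

/-! ### The Berezin kernel -/

section Berezin

variable {H : Type*} [NormedAddCommGroup H] [InnerProductSpace ℂ H]

theorem tsum_pi_foldl {k : ℕ} {ι : Fin k → Type*} (c : ∀ i, ι i → ℝ≥0∞)
    (B : ∀ i, ι i → (H →L[ℂ] H)) (q : H → ℝ≥0∞) (h : H) :
    ∑' β : ∀ i, ι i, (∏ i, c i (β i)) * q (((List.finRange k).map fun i => B i (β i)).prod h) =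
      (List.finRange k).foldl (fun q i h => ∑' α, c i α * q (B i α h)) q h := by
  induction k generalizing q h with
  | zero => simp
  | succ k ih =>
    rw [← (Fin.consEquiv ι).tsum_eq, ENNReal.tsum_prod', ENNReal.tsum_comm, List.finRange_succ,
      List.foldl_cons, List.foldl_map, ← ih (fun i => c i.succ) (fun i => B i.succ)]
    refine tsum_congr fun β => ?_
    rw [← ENNReal.tsum_mul_left]
    refine tsum_congr fun α => ?_
    rw [Fin.prod_univ_succ, List.map_cons, List.prod_cons, List.map_map]
    simp only [Fin.consEquiv_apply, Fin.cons_zero, Fin.cons_succ, Function.comp_def]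
    rw [mul_comm (c 0 α), mul_assoc]
    rfl

variable [CompleteSpace H] {k : ℕ} {n : Fin k → ℕ} {f : ∀ i, PosRegular (n i)} {m : Fin k → ℕ}
  {X : OpTuple n H}

/-- The operator `X_{1,β₁}^* ⋯ X_{k,β_k}^*`. -/
noncomputable def adjointWords (X : OpTuple n H) (β : Words n) : H →L[ℂ] H :=
  ((List.finRange k).map fun i => adjoint (wordOp (X i) (β i))).prod

theorem tsum_words (c : ∀ i, FreeMonoid (Fin (n i)) → ℝ≥0∞) (X : OpTuple n H) (q : H → ℝ≥0∞)
    (h : H) :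
    ∑' β : Words n, (∏ i, c i (β i)) * q (adjointWords X β h) =
      wordForms c X (List.finRange k) q h :=
  tsum_pi_foldl c (fun i α => adjoint (wordOp (X i) α)) q h

theorem prod_sqrt_weight (f : ∀ i, PosRegular (n i)) (m : Fin k → ℕ) (β : Words n) :
    ∏ i, √(weight (f i) (m i) (β i)) = √(∏ i, weight (f i) (m i) (β i)) :=
  (Real.sqrt_prod _ fun i _ => weight_nonneg (f i) (m i) (β i)).symm

theorem ofReal_norm_berezin_entry_sq (hΔ : 0 ≤ defect f X m 1) (β : Words n) (h : H) :
    ENNReal.ofReal (‖((∏ i, √(weight (f i) (m i) (β i)) : ℝ) : ℂ) •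
        opSqrt (defect f X m 1) (adjointWords X β h)‖ ^ 2) =
      (∏ i, eweight (f i) (m i) (β i)) * form (defect f X m 1) (adjointWords X β h) := by
  have hweight : ∀ i ∈ Finset.univ, 0 ≤ weight (f i) (m i) (β i) := fun i _ => weight_nonneg _ _ _
  rw [prod_sqrt_weight, ofReal_norm_sqrt_smul_sq (Finset.prod_nonneg hweight),
    ofReal_norm_opSqrt_sq hΔ, ENNReal.ofReal_prod_of_nonneg hweight]
  rfl

theorem exists_isBerezinKernel (hΔ : 0 ≤ defect f X m 1)
    (hb : ∀ h, wordForms (fun i => eweight (f i) (m i)) X (List.finRange k)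
      (form (defect f X m 1)) h ≤ ENNReal.ofReal (‖h‖ ^ 2)) :
    ∃ K, IsBerezinKernel f m X K := by
  let B : Words n → H →L[ℂ] defectSpace f m X := fun β =>
    (((∏ i, √(weight (f i) (m i) (β i)) : ℝ) : ℂ) •
      (opSqrt (defect f X m 1) ∘L adjointWords X β)).codRestrict (defectSpace f m X)
      fun h => Submodule.smul_mem _ _ (opSqrt_apply_mem hΔ _)
  obtain ⟨K, hK⟩ := exists_column B zero_le_one fun h => by
    rw [one_mul]
    refine le_of_eq_of_le ?_ (hb h)
    rw [← tsum_words]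
    exact tsum_congr fun β => ofReal_norm_berezin_entry_sq hΔ β h
  exact ⟨K, fun h β => by rw [hK]; rfl⟩

theorem isBerezinKernel_berezinKernel (h : ∃ K, IsBerezinKernel f m X K) :
    IsBerezinKernel f m X (berezinKernel f m X) := by
  rw [berezinKernel, dif_pos h]
  exact h.choose_spec

namespace IsBerezinKernel

variable {K : H →L[ℂ] Fock n (defectSpace f m X)} (hK : IsBerezinKernel f m X K)
include hK

theorem ofReal_norm_sq (hΔ : 0 ≤ defect f X m 1) (h : H) :
    ENNReal.ofReal (‖K h‖ ^ 2) = wordForms (fun i => eweight (f i) (m i)) X (List.finRange k)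
      (form (defect f X m 1)) h := by
  rw [ofReal_norm_sq_eq_tsum, ← tsum_words]
  refine tsum_congr fun β => ?_
  have hnorm : ‖K h β‖ = ‖((K h β : defectSpace f m X) : H)‖ := rfl
  rw [hnorm, hK]
  exact ofReal_norm_berezin_entry_sq hΔ β h

end IsBerezinKernel

namespace MemPolydomain

variable (hX : MemPolydomain f m X) (hm : ∀ i, 1 ≤ m i)
include hX hm

theorem isBerezinKernel : IsBerezinKernel f m X (berezinKernel f m X) := by
  refine isBerezinKernel_berezinKernel (exists_isBerezinKernel hX.defect_self_nonneg fun h => ?_)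
  rw [hX.wordForms_form_defect hm]
  refine iSup_le fun q => (form_mono (hX.pureNet_le_one hm q) h).trans_eq ?_
  rw [form_one]

theorem ofReal_norm_berezinKernel_sq (h : H) :
    ENNReal.ofReal (‖berezinKernel f m X h‖ ^ 2) = ⨆ q, form (pureNet f X q) h := by
  rw [(hX.isBerezinKernel hm).ofReal_norm_sq hX.defect_self_nonneg, hX.wordForms_form_defect hm]

theorem tendsto_re_inner_pureNet (h : H) :
    Filter.Tendsto (fun q => RCLike.re (inner ℂ h (pureNet f X q h))) Filter.atTop
      (nhds (‖berezinKernel f m X h‖ ^ 2)) := by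
  have hform : Filter.Tendsto (fun q => form (pureNet f X q) h) Filter.atTop
      (nhds (ENNReal.ofReal (‖berezinKernel f m X h‖ ^ 2))) := by
    rw [hX.ofReal_norm_berezinKernel_sq hm]
    exact tendsto_atTop_iSup fun q q' hq => form_mono (hX.pureNet_mono hm hq) h
  have hreal := (ENNReal.tendsto_toReal ENNReal.ofReal_ne_top).comp hform
  rw [ENNReal.toReal_ofReal (sq_nonneg _)] at hreal
  exact hreal.congr fun q => ENNReal.toReal_ofReal (re_inner_nonneg (hX.pureNet_nonneg hm q) h)

end MemPolydomain

end Berezin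

/-! ### Purity -/

section Purity

variable {H : Type*} [NormedAddCommGroup H] [InnerProductSpace ℂ H]

theorem inner_eq_zero_of_form_eq_zero {A : H →L[ℂ] H} (hA : 0 ≤ A) {x : H} (hx : form A x = 0) :
    inner ℂ (A x) x = 0 := by
  have hre := (ENNReal.ofReal_eq_zero.mp hx).antisymm (re_inner_nonneg hA x)
  rw [← inner_conj_symm, inner_eq_re hA, hre, Complex.ofReal_zero, map_zero]

variable [CompleteSpace H]

theorem tendsto_wot_iff_inner_self {ι : Type*} {l : Filter ι} {A : ι → H →L[ℂ] H}
    {B : H →L[ℂ] H} :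
    Filter.Tendsto (fun i => ContinuousLinearMapWOT.ofCLM (A i)) l
        (nhds (ContinuousLinearMapWOT.ofCLM B)) ↔
      ∀ x, Filter.Tendsto (fun i => inner ℂ x (A i x)) l (nhds (inner ℂ x (B x))) := by
  rw [ContinuousLinearMapWOT.tendsto_iff_forall_inner_apply_tendsto]
  refine ⟨fun h x => h x x, fun h x y => ?_⟩
  change Filter.Tendsto (fun i => inner ℂ y (A i x)) l (nhds (inner ℂ y (B x)))
  have hpol : ∀ C : H →L[ℂ] H, inner ℂ y (C x) =
      (inner ℂ (y + x) (C (y + x)) - inner ℂ (y - x) (C (y - x)) -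
        Complex.I * inner ℂ (y + Complex.I • x) (C (y + Complex.I • x)) +
        Complex.I * inner ℂ (y - Complex.I • x) (C (y - Complex.I • x))) / 4 := fun C => by
    simpa only [ContinuousLinearMap.coe_coe, ContinuousLinearMap.adjoint_inner_left] using
      inner_map_polarization' (adjoint C).toLinearMap y x
  simp only [hpol]
  exact ((((h _).sub (h _)).sub ((h _).const_mul _)).add ((h _).const_mul _)).div_const _

theorem tendsto_wot_iff_re_inner {ι : Type*} {l : Filter ι} {A : ι → H →L[ℂ] H}
    {B : H →L[ℂ] H} (hA : ∀ i, 0 ≤ A i) (hB : 0 ≤ B) :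
    Filter.Tendsto (fun i => ContinuousLinearMapWOT.ofCLM (A i)) l
        (nhds (ContinuousLinearMapWOT.ofCLM B)) ↔
      ∀ x, Filter.Tendsto (fun i => RCLike.re (inner ℂ x (A i x))) l
        (nhds (RCLike.re (inner ℂ x (B x)))) := by
  rw [tendsto_wot_iff_inner_self]
  refine forall_congr' fun x => ⟨fun h => (Complex.continuous_re.tendsto _).comp h, fun h => ?_⟩
  rw [inner_eq_re hB]
  exact ((Complex.continuous_ofReal.tendsto _).comp h).congr fun i => (inner_eq_re (hA i) x).symm

variable {k : ℕ} {n : Fin k → ℕ} {f : ∀ i, PosRegular (n i)} {m : Fin k → ℕ} {X : OpTuple n H}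

namespace MemPolydomain

variable (hX : MemPolydomain f m X) (hm : ∀ i, 1 ≤ m i)
include hX hm

theorem isPure_iff : IsPure f X ↔ ∀ h, ‖berezinKernel f m X h‖ = ‖h‖ := by
  rw [IsPure, tendsto_wot_iff_re_inner (hX.pureNet_nonneg hm) zero_le_one]
  refine forall_congr' fun h => ?_
  rw [← sq_eq_sq₀ (norm_nonneg _) (norm_nonneg _), one_apply_eq_self,
    inner_self_eq_norm_sq]
  have hlim := hX.tendsto_re_inner_pureNet hm h
  exact ⟨tendsto_nhds_unique hlim, fun heq => heq ▸ hlim⟩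

theorem injective_berezinKernel (hc : IsCNC f X) : Function.Injective (berezinKernel f m X) := by
  refine (injective_iff_map_eq_zero _).mpr fun h hh => ?_
  by_contra hne
  refine hc ⟨h, hne, fun q _ => ?_⟩
  have hsup := hX.ofReal_norm_berezinKernel_sq hm h
  rw [hh, norm_zero, zero_pow two_ne_zero, ENNReal.ofReal_zero, eq_comm, ENNReal.iSup_eq_zero]
    at hsup
  rw [hX.cncNet_eq_pureNet]
  exact inner_eq_zero_of_form_eq_zero (hX.pureNet_nonneg hm q) (hsup q)

end MemPolydomain

end Purity

/-! ### The Berezin kernel intertwines the adjoints with those of the universal model -/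

section Intertwining

theorem list_prod_map_update {M ι : Type*} [Monoid M] {l : List ι} (hl : l.Nodup) {g g' : ι → M}
    {i : ι} {a : M} (hi : i ∈ l) (hg : g' i = g i * a) (hne : ∀ j, j ≠ i → g' j = g j)
    (hc : ∀ j, j ≠ i → Commute a (g j)) : (l.map g').prod = (l.map g).prod * a := by
  induction l with
  | nil => exact absurd hi List.not_mem_nil
  | cons j l ih =>
    obtain ⟨hj, hl⟩ := List.nodup_cons.mp hl
    rw [List.map_cons, List.prod_cons, List.map_cons, List.prod_cons]
    obtain rfl | hji := eq_or_ne j i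
    · have hmap : l.map g' = l.map g :=
        List.map_congr_left fun x hx => hne x (ne_of_mem_of_not_mem hx hj)
      have hcomm : Commute a (l.map g).prod := Commute.list_prod_right _ _ <|
        List.forall_mem_map.mpr fun x hx => hc x (ne_of_mem_of_not_mem hx hj)
      rw [hmap, hg, mul_assoc, hcomm.eq, mul_assoc]
    · rw [ih hl ((List.mem_cons.mp hi).resolve_left hji.symm), hne j hji, mul_assoc]

variable {H : Type*} [NormedAddCommGroup H] [InnerProductSpace ℂ H] [CompleteSpace H]
variable {k : ℕ} {n : Fin k → ℕ} {f : ∀ i, PosRegular (n i)} {m : Fin k → ℕ} {X : OpTuple n H}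

theorem adjointWords_consWord (hX : ∀ p q, p ≠ q → ∀ a b, Commute (X p a) (X q b)) (i : Fin k)
    (j : Fin (n i)) (β : Words n) (h : H) :
    adjointWords X (consWord i j β) h = adjointWords X β (adjoint (X i j) h) := by
  have hprod : adjointWords X (consWord i j β) = adjointWords X β * adjoint (X i j) := by
    refine list_prod_map_update (List.nodup_finRange k) (List.mem_finRange i) ?_
      (fun l hl => ?_) fun l hl => ?_
    · ext h
      rw [consWord, Function.update_self, adjoint_wordOp_mul, wordOp_of]
      rfl
    · rw [consWord, Function.update_of_ne hl]
    · exact commute_adjoint (commute_wordOp_right (fun b => hX i l hl.symm j b) _)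
  rw [hprod]
  rfl

theorem prod_sqrt_weight_consWord (f : ∀ i, PosRegular (n i)) (m : Fin k → ℕ) (i : Fin k)
    (j : Fin (n i)) (β : Words n) :
    shiftWeight f m i j β * ∏ l, √(weight (f l) (m l) (consWord i j β l)) =
      ∏ l, √(weight (f l) (m l) (β l)) := by
  classical
  rw [← Finset.mul_prod_erase _ _ (Finset.mem_univ i),
    ← Finset.mul_prod_erase _ _ (Finset.mem_univ i), ← mul_assoc]
  congr 1
  · rw [consWord, Function.update_self, shiftWeight]
    exact div_mul_cancel₀ _ (Real.sqrt_pos.mpr (weight_pos _ _ _)).ne'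
  · refine Finset.prod_congr rfl fun l hl => ?_
    rw [consWord, Function.update_of_ne (Finset.ne_of_mem_erase hl)]

theorem adjoint_universal_apply {D : Type*} [NormedAddCommGroup D] [InnerProductSpace ℂ D]
    [CompleteSpace D] (f : ∀ i, PosRegular (n i)) (m : Fin k → ℕ) (i : Fin k) (j : Fin (n i))
    (x : Fock n D) (β : Words n) :
    (adjoint (universal D f m i j) x : Fock n D) β =
      ((shiftWeight f m i j β : ℝ) : ℂ) • x (consWord i j β) := by
  classical
  refine ext_inner_left ℂ fun d => ?_
  have hsingle : ∀ (γ : Words n) (d : D) (y : Fock n D),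
      inner ℂ (lp.single 2 γ d : Fock n D) y = inner ℂ d (y γ) :=
    fun γ d y => lp.inner_single_left γ d y
  rw [← hsingle, ContinuousLinearMap.adjoint_inner_right, universal_single, hsingle,
    inner_smul_left, inner_smul_right, Complex.conj_ofReal]
  rfl

theorem IsBerezinKernel.intertwine {K : H →L[ℂ] Fock n (defectSpace f m X)}
    (hK : IsBerezinKernel f m X K) (hX : ∀ p q, p ≠ q → ∀ a b, Commute (X p a) (X q b)) (i : Fin k)
    (j : Fin (n i)) (h : H) :
    K (adjoint (X i j) h) = adjoint (universal (defectSpace f m X) f m i j) (K h) := by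
  ext β
  have hwords := adjointWords_consWord hX i j β h
  rw [adjointWords, adjointWords] at hwords
  rw [adjoint_universal_apply, Submodule.coe_smul, hK, hK, smul_smul, hwords,
    ← Complex.ofReal_mul, prod_sqrt_weight_consWord]

end Intertwining

/-! ### Recovering defects from sums of forms -/

section FormDefect

variable {H : Type*} [NormedAddCommGroup H] [InnerProductSpace ℂ H]

theorem le_of_form_le {A B : H →L[ℂ] H} (hA : 0 ≤ A) (hB : 0 ≤ B) (h : form A ≤ form B) :
    A ≤ B := by
  refine (ContinuousLinearMap.le_def A B).mpr
    ((ContinuousLinearMap.nonneg_iff_isPositive _).mp (nonneg_of_inner_eq_re fun x =>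
    ⟨RCLike.re (inner ℂ x (B x)) - RCLike.re (inner ℂ x (A x)), ?_, ?_⟩))
  · exact sub_nonneg.mpr ((ENNReal.ofReal_le_ofReal_iff (re_inner_nonneg hB x)).mp (h x))
  · rw [sub_apply, inner_sub_right, Complex.ofReal_sub, ← inner_eq_re hA, ← inner_eq_re hB]

variable [CompleteSpace H]

section

variable {N : ℕ} {f : PosRegular N} {X : Fin N → (H →L[ℂ] H)} (hX : Summable (phiTerm f X 1))
  {Z : H →L[ℂ] H} (hZ : 0 ≤ Z) {q : H → ℝ≥0∞}
include hZ

theorem one_sub_of_form_eq (h : form Z = geomForm (ecoeff f) X q) :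
    0 ≤ (1 - phiEnd hX) Z ∧ form ((1 - phiEnd hX) Z) = q := by
  have hΦ : 0 ≤ phiEnd hX Z := phiEnd_nonneg hX hZ
  have hle : form (phiEnd hX Z) ≤ form Z := by
    rw [form_phiEnd hX hZ, h]
    exact wordForm_geomForm_le _ X q
  have hsub : 0 ≤ (1 - phiEnd hX) Z := sub_nonneg.mpr (le_of_form_le hΦ hZ hle)
  refine ⟨hsub, funext fun x => ?_⟩
  refine (ENNReal.add_left_inj (a := form (phiEnd hX Z) x) ENNReal.ofReal_ne_top).mp ?_
  rw [← form_add hsub hΦ, LinearMap.sub_apply, Module.End.one_apply, sub_add_cancel,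
    form_phiEnd hX hZ, h]
  exact geomForm_eq _ X q x

theorem one_sub_pow_of_form_eq (m : ℕ) (h : form Z = (geomForm (ecoeff f) X)^[m] q) :
    0 ≤ ((1 - phiEnd hX) ^ m) Z ∧ form (((1 - phiEnd hX) ^ m) Z) = q := by
  induction m generalizing Z with
  | zero => exact ⟨hZ, h⟩
  | succ m ih =>
    rw [Function.iterate_succ_apply'] at h
    obtain ⟨hnonneg, hform⟩ := one_sub_of_form_eq hX hZ h
    exact ih hnonneg hform

end

variable {k : ℕ} {n : Fin k → ℕ} {f : ∀ i, PosRegular (n i)} {m : Fin k → ℕ} {X : OpTuple n H}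

theorem defectProd_of_form_eq (hX : ∀ i, Summable (phiTerm (f i) (X i) 1)) (hm : ∀ i, 1 ≤ m i)
    {l : List (Fin k)} {Z : H →L[ℂ] H} (hZ : 0 ≤ Z) {q : H → ℝ≥0∞}
    (h : form Z = wordForms (fun i => eweight (f i) (m i)) X l q) :
    0 ≤ defectProd (fun i => phiEnd (hX i)) m l Z ∧
      form (defectProd (fun i => phiEnd (hX i)) m l Z) = q := by
  induction l generalizing q with
  | nil => exact ⟨hZ, h⟩
  | cons i l ih =>
    rw [wordForms_cons] at h
    obtain ⟨hnonneg, hform⟩ := ih h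
    rw [wordForm_eweight _ _ (hm i)] at hform
    rw [defectProd_cons]
    exact one_sub_pow_of_form_eq (hX i) hnonneg (m i) hform

theorem wordForm_ecoeff_wordForm_eweight_le {N : ℕ} (g : PosRegular N)
    (Z : Fin N → (H →L[ℂ] H)) {p : ℕ} (hp : 1 ≤ p) (q : H → ℝ≥0∞) :
    wordForm (ecoeff g) Z (wordForm (eweight g p) Z q) ≤ wordForm (eweight g p) Z q := by
  obtain ⟨p, rfl⟩ := Nat.exists_eq_add_of_le' hp
  rw [wordForm_eweight _ _ hp, Function.iterate_succ_apply']
  exact wordForm_geomForm_le _ Z _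

theorem wordForm_wordForms_comm {c : ∀ i, FreeMonoid (Fin (n i)) → ℝ≥0∞} {i : Fin k}
    (d : FreeMonoid (Fin (n i)) → ℝ≥0∞)
    (hX : ∀ p q, p ≠ q → ∀ a b, Commute (X p a) (X q b)) {l : List (Fin k)} (hi : i ∉ l)
    (q : H → ℝ≥0∞) :
    wordForm d (X i) (wordForms c X l q) = wordForms c X l (wordForm d (X i) q) := by
  induction l generalizing q with
  | nil => rfl
  | cons j l ih =>
    obtain ⟨hij, hl⟩ := not_or.mp (List.mem_cons.not.mp hi)
    rw [wordForms_cons, wordForms_cons, ih hl, wordForm_comm _ _ (hX i j hij)]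

theorem wordForm_wordForms_le (hX : ∀ p q, p ≠ q → ∀ a b, Commute (X p a) (X q b))
    (hm : ∀ i, 1 ≤ m i) {i : Fin k} {l : List (Fin k)} (hl : l.Nodup) (hi : i ∈ l)
    (q : H → ℝ≥0∞) :
    wordForm (ecoeff (f i)) (X i) (wordForms (fun i => eweight (f i) (m i)) X l q) ≤
      wordForms (fun i => eweight (f i) (m i)) X l q := by
  induction l generalizing q with
  | nil => exact absurd hi List.not_mem_nil
  | cons j l ih =>
    obtain ⟨hj, hl⟩ := List.nodup_cons.mp hl
    rw [wordForms_cons]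
    obtain rfl | hil := List.mem_cons.mp hi
    · rw [wordForm_wordForms_comm _ hX hj]
      exact wordForms_mono _ X l (wordForm_ecoeff_wordForm_eweight_le _ _ (hm i) q)
    · exact ih hl hil _

end FormDefect

/-! ### The universal model -/

section Universal

variable {k : ℕ} {n : Fin k → ℕ}

theorem consWord_comm {i p : Fin k} (h : i ≠ p) (a : Fin (n i)) (b : Fin (n p)) (β : Words n) :
    consWord i a (consWord p b β) = consWord p b (consWord i a β) := by
  unfold consWord
  rw [Function.update_of_ne h, Function.update_of_ne h.symm, Function.update_comm h]

section

variable (f : ∀ i, PosRegular (n i)) (m : Fin k → ℕ)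

/-- The coefficient `√b_{β₁} ⋯ √b_{β_k}` of `e_β` in the Berezin kernel. -/
noncomputable def sqrtWeight (β : Words n) : ℝ := ∏ i, √(weight (f i) (m i) (β i))

theorem sqrtWeight_pos (β : Words n) : 0 < sqrtWeight f m β :=
  Finset.prod_pos fun _ _ => Real.sqrt_pos.mpr (weight_pos _ _ _)

theorem sqrtWeight_one : sqrtWeight f m 1 = 1 :=
  Finset.prod_eq_one fun i _ => by rw [Pi.one_apply, weight_one, Real.sqrt_one]

theorem shiftWeight_mul_sqrtWeight_consWord (i : Fin k) (j : Fin (n i)) (β : Words n) :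
    shiftWeight f m i j β * sqrtWeight f m (consWord i j β) = sqrtWeight f m β :=
  prod_sqrt_weight_consWord f m i j β

end

variable {D : Type*} [NormedAddCommGroup D] [InnerProductSpace ℂ D]

/-- The coordinates of `x` in the orthogonal basis `√b_{β₁} ⋯ √b_{β_k} e_β`, in which the adjoints
of the universal model act as unweighted backward shifts. -/
noncomputable def normCoord (f : ∀ i, PosRegular (n i)) (m : Fin k → ℕ) (x : Fock n D)
    (β : Words n) : D :=
  (((sqrtWeight f m β)⁻¹ : ℝ) : ℂ) • x β

variable {f : ∀ i, PosRegular (n i)} {m : Fin k → ℕ}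

theorem sqrtWeight_smul_normCoord (x : Fock n D) (β : Words n) :
    ((sqrtWeight f m β : ℝ) : ℂ) • normCoord f m x β = x β := by
  rw [normCoord, smul_smul, ← Complex.ofReal_mul, mul_inv_cancel₀ (sqrtWeight_pos f m β).ne',
    Complex.ofReal_one, one_smul]

theorem normCoord_one (x : Fock n D) : normCoord f m x 1 = x 1 := by
  rw [normCoord, sqrtWeight_one, inv_one, Complex.ofReal_one, one_smul]

theorem normCoord_injective {x y : Fock n D} (h : ∀ β, normCoord f m x β = normCoord f m y β) :
    x = y := by
  ext β
  rw [← sqrtWeight_smul_normCoord (f := f) (m := m), h, sqrtWeight_smul_normCoord]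

variable [CompleteSpace D]

theorem normCoord_adjoint_universal (i : Fin k) (j : Fin (n i)) (x : Fock n D) (β : Words n) :
    normCoord f m (adjoint (universal D f m i j) x) β = normCoord f m x (consWord i j β) := by
  rw [normCoord, normCoord, adjoint_universal_apply, smul_smul, ← Complex.ofReal_mul]
  congr 2
  rw [inv_mul_eq_iff_eq_mul₀ (sqrtWeight_pos f m β).ne',
    eq_mul_inv_iff_mul_eq₀ (sqrtWeight_pos f m _).ne', shiftWeight_mul_sqrtWeight_consWord]

theorem universal_commute {i p : Fin k} (h : i ≠ p) (a : Fin (n i)) (b : Fin (n p)) :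
    Commute (universal D f m i a) (universal D f m p b) := by
  refine adjoint.injective (ContinuousLinearMap.ext fun x =>
    normCoord_injective (f := f) (m := m) fun β => ?_)
  simp only [ContinuousLinearMap.mul_def, ContinuousLinearMap.adjoint_comp,
    ContinuousLinearMap.comp_apply, normCoord_adjoint_universal]
  rw [consWord_comm h]

theorem normCoord_adjoint_wordOp (i : Fin k) (α : FreeMonoid (Fin (n i))) (x : Fock n D)
    (β : Words n) :
    normCoord f m (adjoint (wordOp (universal D f m i) α) x) β =
      normCoord f m x (Function.update β i (α * β i)) := by
  induction α using FreeMonoid.inductionOn' generalizing x with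
  | one => rw [adjoint_wordOp_one, one_mul, Function.update_eq_self]
  | of_mul a α ih =>
    rw [adjoint_wordOp_mul, ih, wordOp_of, normCoord_adjoint_universal, consWord,
      Function.update_self, Function.update_idem, mul_assoc]

theorem normCoord_list_prod_adjoint_wordOp (β : Words n) (x : Fock n D) {l : List (Fin k)}
    (hl : l.Nodup) (γ : Words n) :
    normCoord f m ((l.map fun i => adjoint (wordOp (universal D f m i) (β i))).prod x) γ =
      normCoord f m x fun i => if i ∈ l then β i * γ i else γ i := by
  induction l generalizing γ with
  | nil => simp
  | cons i l ih =>
    obtain ⟨hi, hl⟩ := List.nodup_cons.mp hl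
    rw [List.map_cons, List.prod_cons, mul_apply_eq_comp, normCoord_adjoint_wordOp, ih hl]
    congr 1
    funext j
    obtain rfl | hji := eq_or_ne j i
    · rw [if_neg hi, if_pos List.mem_cons_self, Function.update_self]
    · simp only [Function.update_of_ne hji, List.mem_cons, hji, false_or]

theorem adjointWords_universal_apply_one (β : Words n) (x : Fock n D) :
    adjointWords (fun i j => universal D f m i j) β x 1 = normCoord f m x β := by
  rw [← normCoord_one (f := f) (m := m), adjointWords,
    normCoord_list_prod_adjoint_wordOp β x (List.nodup_finRange k)]
  simp

/-- The form of the projection onto the vacuum vectors, which is the defect of the universal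
model. -/
noncomputable def vacuumForm (x : Fock n D) : ℝ≥0∞ := ENNReal.ofReal (‖x 1‖ ^ 2)

theorem wordForms_vacuumForm :
    wordForms (fun i => eweight (f i) (m i)) (fun i j => universal D f m i j) (List.finRange k)
      vacuumForm = form (1 : Fock n D →L[ℂ] Fock n D) := by
  funext x
  have hweight : ∀ (β : Words n), ∀ i ∈ Finset.univ, 0 ≤ weight (f i) (m i) (β i) :=
    fun β i _ => weight_nonneg _ _ _
  simp only [form_one]
  rw [← tsum_words, ofReal_norm_sq_eq_tsum]
  refine tsum_congr fun β => ?_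
  rw [vacuumForm, adjointWords_universal_apply_one, ← sqrtWeight_smul_normCoord (f := f) (m := m) x,
    sqrtWeight, prod_sqrt_weight, ofReal_norm_sqrt_smul_sq (Finset.prod_nonneg (hweight β)),
    ENNReal.ofReal_prod_of_nonneg (hweight β)]
  rfl

variable (hm : ∀ i, 1 ≤ m i)
include hm

theorem summable_phiTerm_universal (i : Fin k) (Y : Fock n D →L[ℂ] Fock n D) :
    Summable (phiTerm (f i) (universal D f m i) Y) := by
  refine summable_phiTerm_of_bound zero_le_one (fun x => ?_) Y
  have hle := wordForm_wordForms_le (f := f) (X := fun i j => universal D f m i j)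
    (fun p q hpq a b => universal_commute hpq a b) hm (List.nodup_finRange k)
    (List.mem_finRange i) vacuumForm x
  rw [wordForms_vacuumForm] at hle
  refine hle.trans_eq ?_
  rw [form_one, one_mul]

theorem defect_universal :
    0 ≤ defect f (fun i j => universal D f m i j) m 1 ∧
      form (defect f (fun i j => universal D f m i j) m 1) = vacuumForm := by
  rw [defect_eq_defectProd fun i => summable_phiTerm_universal hm i 1]
  exact defectProd_of_form_eq _ hm zero_le_one wordForms_vacuumForm.symm

end Universal

/-! ### Compressions to coinvariant subspaces -/

section Compression

variable {S : Type*} [NormedAddCommGroup S] [InnerProductSpace ℂ S] [CompleteSpace S]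
variable {F : Type*} [NormedAddCommGroup F] [InnerProductSpace ℂ F] [CompleteSpace F]
variable {C : S →L[ℂ] F}

theorem form_compression (Z : F →L[ℂ] F) (s : S) :
    form (adjoint C ∘L Z ∘L C) s = form Z (C s) := by
  rw [form, ContinuousLinearMap.comp_apply, ContinuousLinearMap.adjoint_inner_right]
  rfl

theorem compression_nonneg {Z : F →L[ℂ] F} (hZ : 0 ≤ Z) : 0 ≤ adjoint C ∘L Z ∘L C := by
  rw [ContinuousLinearMap.nonneg_iff_isPositive] at hZ ⊢
  exact hZ.adjoint_conj C

section SingleTuple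

variable {N : ℕ} {f : PosRegular N} {M : Fin N → (S →L[ℂ] S)} {W : Fin N → (F →L[ℂ] F)}
  (h : ∀ j s, C (adjoint (M j) s) = adjoint (W j) (C s))
include h

theorem intertwine_adjoint_wordOp (α : FreeMonoid (Fin N)) (s : S) :
    C (adjoint (wordOp M α) s) = adjoint (wordOp W α) (C s) := by
  induction α using FreeMonoid.inductionOn' generalizing s with
  | one => rw [adjoint_wordOp_one, adjoint_wordOp_one]
  | of_mul a α ih => rw [adjoint_wordOp_mul, adjoint_wordOp_mul, ih, wordOp_of, wordOp_of, h]

theorem phi_compression {Z : F →L[ℂ] F} (hW : Summable (phiTerm f W Z)) :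
    phi f M (adjoint C ∘L Z ∘L C) = adjoint C ∘L phi f W Z ∘L C := by
  have hsum : HasSum (phiTerm f M (adjoint C ∘L Z ∘L C))
      (ContinuousLinearMapWOT.ofCLM (adjoint C ∘L phi f W Z ∘L C)) := by
    refine hasSum_wot_iff.mpr fun u v => ?_
    have hadj : ∀ (A : F →L[ℂ] F) (s t : S),
        inner ℂ s ((adjoint C ∘L A ∘L C) t) = inner ℂ (C s) (A (C t)) := fun A s t =>
      C.adjoint_inner_right s _
    rw [show inner ℂ u (ContinuousLinearMapWOT.ofCLM (adjoint C ∘L phi f W Z ∘L C) v) = _ from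
      hadj _ u v]
    refine (hasSum_inner_phi hW (C u) (C v)).congr_fun fun α => ?_
    rw [inner_phiTerm, hadj, intertwine_adjoint_wordOp h, intertwine_adjoint_wordOp h]
  rw [phi, hsum.tsum_eq]

theorem iterate_sub_phi_compression (hW : Summable (phiTerm f W 1)) (r : ℕ) (Y : F →L[ℂ] F) :
    (fun Y' => Y' - phi f M Y')^[r] (adjoint C ∘L Y ∘L C) =
      adjoint C ∘L ((fun Y' => Y' - phi f W Y')^[r] Y) ∘L C := by
  induction r generalizing Y with
  | zero => rfl
  | succ r ih =>
    rw [Function.iterate_succ_apply, Function.iterate_succ_apply, ← ih,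
      phi_compression h (summable_phiTerm hW Y), ContinuousLinearMap.sub_comp,
      ContinuousLinearMap.comp_sub]

end SingleTuple

variable {k : ℕ} {n : Fin k → ℕ} {f : ∀ i, PosRegular (n i)} {M : OpTuple n S} {W : OpTuple n F}
  (h : ∀ i j s, C (adjoint (M i j) s) = adjoint (W i j) (C s))
include h

theorem defect_compression (hW : ∀ i, Summable (phiTerm (f i) (W i) 1)) (p : Fin k → ℕ)
    (Z : F →L[ℂ] F) :
    defect f M p (adjoint C ∘L Z ∘L C) = adjoint C ∘L defect f W p Z ∘L C := by
  unfold defect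
  induction List.finRange k with
  | nil => rfl
  | cons i l ih =>
    rw [List.foldr_cons, List.foldr_cons, ih, iterate_sub_phi_compression (h i) (hW i)]

theorem intertwine_adjointWords (β : Words n) (s : S) :
    C (adjointWords M β s) = adjointWords W β (C s) := by
  unfold adjointWords
  induction List.finRange k with
  | nil => rfl
  | cons i l ih =>
    rw [List.map_cons, List.map_cons, List.prod_cons, List.prod_cons, mul_apply_eq_comp,
      mul_apply_eq_comp, intertwine_adjoint_wordOp (h i), ih]

theorem commute_compression (hC : Function.Injective C) {i p : Fin k} {a : Fin (n i)}
    {b : Fin (n p)} (hW : Commute (W i a) (W p b)) : Commute (M i a) (M p b) := by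
  have hadj : Commute (adjoint (M p b)) (adjoint (M i a)) := by
    refine ContinuousLinearMap.ext fun s => hC ?_
    rw [mul_apply_eq_comp, mul_apply_eq_comp, h, h, h, h]
    exact DFunLike.congr_fun (commute_adjoint hW).eq.symm (C s)
  simpa only [ContinuousLinearMap.adjoint_adjoint] using (commute_adjoint hadj).symm

end Compression

section UniversalCompression

variable {S : Type*} [NormedAddCommGroup S] [InnerProductSpace ℂ S] [CompleteSpace S]
variable {E : Type*} [NormedAddCommGroup E] [InnerProductSpace ℂ E] [CompleteSpace E]
variable {k : ℕ} {n : Fin k → ℕ} {f : ∀ i, PosRegular (n i)} {m : Fin k → ℕ} {M : OpTuple n S}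
  {C : S →L[ℂ] Fock n E} (hm : ∀ i, 1 ≤ m i)
  (h : ∀ i j s, C (adjoint (M i j) s) = adjoint (universal E f m i j) (C s))
  (hC : ∀ s, ‖C s‖ = ‖s‖)
include hm h hC

theorem defect_universal_compression :
    defect f M m 1 = adjoint C ∘L defect f (fun i j => universal E f m i j) m 1 ∘L C := by
  have hCC : adjoint C ∘L (1 : Fock n E →L[ℂ] Fock n E) ∘L C = 1 :=
    C.norm_map_iff_adjoint_comp_self.mp hC
  rw [← defect_compression h fun i => summable_phiTerm_universal hm i 1, hCC]

theorem defect_universal_compression_nonneg : 0 ≤ defect f M m 1 := by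
  rw [defect_universal_compression hm h hC]
  exact compression_nonneg (defect_universal hm).1

theorem wordForms_form_defect_universal_compression :
    wordForms (fun i => eweight (f i) (m i)) M (List.finRange k) (form (defect f M m 1)) =
      form 1 := by
  funext s
  have hvac := congrFun (wordForms_vacuumForm (D := E) (f := f) (m := m)) (C s)
  simp only [form_one, ← tsum_words, hC] at hvac ⊢
  rw [← hvac]
  refine tsum_congr fun β => ?_
  rw [defect_universal_compression hm h hC, form_compression, (defect_universal hm).2,
    intertwine_adjointWords h]

theorem isBerezinKernel_of_universal_compression :
    IsBerezinKernel f m M (berezinKernel f m M) := by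
  refine isBerezinKernel_berezinKernel
    (exists_isBerezinKernel (defect_universal_compression_nonneg hm h hC) fun s => ?_)
  rw [wordForms_form_defect_universal_compression hm h hC, form_one]

theorem norm_berezinKernel_of_universal_compression (s : S) : ‖berezinKernel f m M s‖ = ‖s‖ := by
  have hnorm := (isBerezinKernel_of_universal_compression hm h hC).ofReal_norm_sq
    (defect_universal_compression_nonneg hm h hC) s
  rw [wordForms_form_defect_universal_compression hm h hC, form_one,
    ENNReal.ofReal_eq_ofReal_iff (sq_nonneg _) (sq_nonneg _)] at hnorm
  exact (sq_eq_sq₀ (norm_nonneg _) (norm_nonneg _)).mp hnorm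

end UniversalCompression

/-! ### Partial isometries and complementary factorizations -/

section PartialIsometry

variable {H : Type*} [NormedAddCommGroup H] [InnerProductSpace ℂ H]
variable {F : Type*} [NormedAddCommGroup F] [InnerProductSpace ℂ F] {K : H →L[ℂ] F}

theorem norm_eq_of_isPartialIsometry_of_injective (hK : IsPartialIsometry K)
    (hinj : Function.Injective K) (y : H) : ‖K y‖ = ‖y‖ := by
  refine hK y ?_
  rw [LinearMap.ker_eq_bot.mpr hinj, Submodule.bot_orthogonal_eq_top]
  exact Submodule.mem_top

variable [CompleteSpace H] [CompleteSpace F]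
variable {G : Type*} [NormedAddCommGroup G] [InnerProductSpace ℂ G] [CompleteSpace G]
  {Θ : G →L[ℂ] F}

theorem adjoint_apply_apply_of_isometry (hK : ∀ y, ‖K y‖ = ‖y‖) (y : H) :
    adjoint K (K y) = y :=
  DFunLike.congr_fun (K.norm_map_iff_adjoint_comp_self.mp hK) y

theorem comp_eq_comp_iff_adjoint {W : G →L[ℂ] G} {V : F →L[ℂ] F} :
    Θ ∘L W = V ∘L Θ ↔ ∀ x, adjoint W (adjoint Θ x) = adjoint Θ (adjoint V x) := by
  rw [← adjoint.injective.eq_iff, ContinuousLinearMap.adjoint_comp,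
    ContinuousLinearMap.adjoint_comp]
  exact ContinuousLinearMap.ext_iff

theorem isPartialIsometry_iff_norm_adjoint :
    IsPartialIsometry Θ ↔ ∀ z, ‖Θ (adjoint Θ z)‖ = ‖adjoint Θ z‖ := by
  refine ⟨fun hΘ z => hΘ _ fun x hx => ?_, fun hΘ x hx => ?_⟩
  · rw [ContinuousLinearMap.adjoint_inner_right, show Θ x = 0 from hx, inner_zero_left]
  · rw [ContinuousLinearMap.orthogonal_ker] at hx
    refine closure_minimal (s := Set.range (adjoint Θ)) (t := {x | ‖Θ x‖ = ‖x‖}) ?_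
      (isClosed_eq Θ.continuous.norm continuous_norm) hx
    rintro _ ⟨z, rfl⟩
    exact hΘ z

theorem isPartialIsometry_iff_isIdempotentElem :
    IsPartialIsometry Θ ↔ IsIdempotentElem (Θ ∘L adjoint Θ) := by
  have hsq : ∀ z, inner ℂ ((Θ ∘L adjoint Θ) ((Θ ∘L adjoint Θ) z)) z =
      ((‖Θ (adjoint Θ z)‖ ^ 2 : ℝ) : ℂ) := fun z => by
    rw [ContinuousLinearMap.comp_apply, ← ContinuousLinearMap.adjoint_inner_right,
      ContinuousLinearMap.adjoint_inner_left, ContinuousLinearMap.comp_apply,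
      inner_self_eq_norm_sq_to_K, Complex.ofReal_pow]
    rfl
  have hself : ∀ z, inner ℂ ((Θ ∘L adjoint Θ) z) z = ((‖adjoint Θ z‖ ^ 2 : ℝ) : ℂ) := fun z => by
    rw [ContinuousLinearMap.comp_apply, ← ContinuousLinearMap.adjoint_inner_right,
      inner_self_eq_norm_sq_to_K, Complex.ofReal_pow]
    rfl
  rw [isPartialIsometry_iff_norm_adjoint]
  refine ⟨fun hΘ => ?_, fun hΘ z => ?_⟩
  · refine ContinuousLinearMap.coe_injective ((ext_inner_map _ _).mp fun z => ?_)
    exact (hsq z).trans ((congrArg (fun r : ℝ => ((r ^ 2 : ℝ) : ℂ)) (hΘ z)).trans (hself z).symm)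
  · refine (sq_eq_sq₀ (norm_nonneg _) (norm_nonneg _)).mp (Complex.ofReal_injective ?_)
    rw [← hsq, ← hself, ← mul_apply_eq_comp, hΘ.eq]

variable (h : K ∘L adjoint K + Θ ∘L adjoint Θ = 1)
include h

theorem isPartialIsometry_iff_of_comp_adjoint_add_eq_one :
    IsPartialIsometry K ↔ IsPartialIsometry Θ := by
  rw [isPartialIsometry_iff_isIdempotentElem, isPartialIsometry_iff_isIdempotentElem,
    ← IsIdempotentElem.one_sub_iff, ← h, add_sub_cancel_left]

theorem adjoint_apply_eq_zero_of_isometry (hK : ∀ y, ‖K y‖ = ‖y‖) (y : H) :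
    adjoint Θ (K y) = 0 := by
  have hsum : K (adjoint K (K y)) + Θ (adjoint Θ (K y)) = K y := DFunLike.congr_fun h (K y)
  rw [adjoint_apply_apply_of_isometry hK, add_eq_left] at hsum
  rw [← inner_self_eq_zero (𝕜 := ℂ), ContinuousLinearMap.adjoint_inner_left, hsum,
    inner_zero_right]

theorem exists_unitary_of_isometry (hK : ∀ y, ‖K y‖ = ‖y‖) :
    ∃ U : H ≃ₗᵢ[ℂ] (LinearMap.range Θ.toLinearMap)ᗮ, ∀ y, (U y : F) = K y := by
  have hmem : ∀ y : F, y ∈ (LinearMap.range Θ.toLinearMap)ᗮ ↔ adjoint Θ y = 0 := fun y => by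
    rw [ContinuousLinearMap.orthogonal_range]
    rfl
  let V : H →ₗᵢ[ℂ] (LinearMap.range Θ.toLinearMap)ᗮ :=
    { toLinearMap := K.toLinearMap.codRestrict _
        fun y => (hmem _).mpr (adjoint_apply_eq_zero_of_isometry h hK y)
      norm_map' := hK }
  have hV : Function.Surjective V := fun y => by
    have hsum : K (adjoint K y) + Θ (adjoint Θ y) = y := DFunLike.congr_fun h (y : F)
    rw [(hmem _).mp y.2, map_zero, add_zero] at hsum
    exact ⟨adjoint K y, Subtype.ext hsum⟩
  exact ⟨LinearIsometryEquiv.ofSurjective V hV, fun _ => rfl⟩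

end PartialIsometry

theorem eq_symm_compression {H : Type*} [NormedAddCommGroup H] [InnerProductSpace ℂ H]
    [CompleteSpace H] {F : Type*} [NormedAddCommGroup F] [InnerProductSpace ℂ F] [CompleteSpace F]
    {K : H →L[ℂ] F} {S : Submodule ℂ F} [S.HasOrthogonalProjection] (U : H ≃ₗᵢ[ℂ] S)
    (hU : ∀ y, (U y : F) = K y) {A : H →L[ℂ] H} {V : F →L[ℂ] F}
    (hA : ∀ y, K (adjoint A y) = adjoint V (K y)) (y : H) :
    A y = U.symm ((S.orthogonalProjectionOnto ∘L V ∘L S.subtypeL) (U y)) := by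
  rw [LinearIsometryEquiv.eq_symm_apply]
  refine ext_inner_right ℂ fun z => ?_
  obtain ⟨z, rfl⟩ := U.surjective z
  rw [LinearIsometryEquiv.inner_map_map, ContinuousLinearMap.comp_apply,
    Submodule.inner_orthogonalProjectionOnto_eq_of_mem_right, ContinuousLinearMap.comp_apply,
    ← ContinuousLinearMap.adjoint_inner_right, ← ContinuousLinearMap.adjoint_inner_right, hU, ← hA,
    ← hU, Submodule.subtypeL_apply, ← Submodule.coe_inner, LinearIsometryEquiv.inner_map_map]

/-! ### The square root as an operator into the closure of the range -/

section SqrtRange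

variable {F : Type*} [NormedAddCommGroup F] [InnerProductSpace ℂ F]

/-- The closure of the range of an operator. -/
abbrev rangeClosure (Y : F →L[ℂ] F) : Submodule ℂ F :=
  (LinearMap.range Y.toLinearMap).topologicalClosure

variable [CompleteSpace F] {Y : F →L[ℂ] F} (hY : 0 ≤ Y)

/-- `Y^{1/2}` as an operator into the closure of the range of `Y`. -/
noncomputable def sqrtRange : F →L[ℂ] rangeClosure Y :=
  (opSqrt Y).codRestrict (rangeClosure Y) (opSqrt_apply_mem hY)

theorem adjoint_sqrtRange :
    adjoint (sqrtRange hY) = opSqrt Y ∘L (rangeClosure Y).subtypeL := by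
  refine ((ContinuousLinearMap.eq_adjoint_iff _ _).mpr fun s x => ?_).symm
  change inner ℂ (opSqrt Y s) x = inner ℂ (s : F) (opSqrt Y x)
  rw [← ContinuousLinearMap.adjoint_inner_right, adjoint_opSqrt]

theorem adjoint_sqrtRange_apply (x : F) : adjoint (sqrtRange hY) (sqrtRange hY x) = Y x := by
  rw [adjoint_sqrtRange]
  exact opSqrt_opSqrt_apply hY x

theorem denseRange_sqrtRange : DenseRange (sqrtRange hY) := by
  change Dense (LinearMap.range (sqrtRange hY).toLinearMap : Set (rangeClosure Y))
  rw [Submodule.dense_iff_topologicalClosure_eq_top, Submodule.topologicalClosure_eq_top_iff,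
    Submodule.eq_bot_iff]
  intro s hs
  have horth : (s : F) ∈ (LinearMap.range Y.toLinearMap)ᗮ := by
    rintro _ ⟨x, rfl⟩
    have hzero : inner ℂ (opSqrt Y (opSqrt Y x)) (s : F) = 0 :=
      hs (sqrtRange hY (opSqrt Y x)) ⟨_, rfl⟩
    rwa [opSqrt_opSqrt_apply hY] at hzero
  have hclosure : (s : F) ∈ (LinearMap.range Y.toLinearMap)ᗮᗮ :=
    (Submodule.orthogonal_orthogonal_eq_closure (LinearMap.range Y.toLinearMap)).symm ▸ s.2
  exact Subtype.ext (inner_self_eq_zero.mp (hclosure _ horth))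

variable {G : Type*} [NormedAddCommGroup G] [InnerProductSpace ℂ G] [CompleteSpace G]

theorem norm_adjoint_of_factorization {Ψ : G →L[ℂ] F} (hΨ : Y = Ψ ∘L adjoint Ψ) (x : F) :
    ‖adjoint Ψ x‖ = ‖sqrtRange hY x‖ := by
  refine (sq_eq_sq₀ (norm_nonneg _) (norm_nonneg _)).mp ?_
  rw [← inner_self_eq_norm_sq (𝕜 := ℂ), ← inner_self_eq_norm_sq (𝕜 := ℂ) (sqrtRange hY x),
    ContinuousLinearMap.adjoint_inner_right, ← (sqrtRange hY).adjoint_inner_left,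
    adjoint_sqrtRange_apply]
  exact congrArg (fun A : F →L[ℂ] F => RCLike.re (inner ℂ (A x) x)) hΨ.symm

theorem exists_isometry_of_factorization {Ψ : G →L[ℂ] F} (hΨ : Y = Ψ ∘L adjoint Ψ) :
    ∃ C : rangeClosure Y →L[ℂ] G, (∀ s, ‖C s‖ = ‖s‖) ∧
      ∀ x, C (sqrtRange hY x) = adjoint Ψ x := by
  have hdense := denseRange_sqrtRange hY
  have hnorm := norm_adjoint_of_factorization hY hΨ
  let C : rangeClosure Y →L[ℂ] G :=
    (adjoint Ψ).toLinearMap.extendOfNorm (sqrtRange hY).toLinearMap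
  have hCR : ∀ x, C (sqrtRange hY x) = adjoint Ψ x := fun x =>
    LinearMap.extendOfNorm_eq hdense ⟨1, fun y => by rw [one_mul]; exact (hnorm y).le⟩ x
  refine ⟨C, congrFun (hdense.equalizer C.continuous.norm continuous_norm ?_), hCR⟩
  funext x
  rw [Function.comp_apply, Function.comp_apply, hCR, hnorm]

section Intertwine

variable {Ψ : G →L[ℂ] F} {C : rangeClosure Y →L[ℂ] G} {V : F →L[ℂ] F} {W : G →L[ℂ] G}
  (hCR : ∀ x, C (sqrtRange hY x) = adjoint Ψ x) (hmul : Ψ ∘L W = V ∘L Ψ)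
include hCR hmul

theorem exists_compression (hC : ∀ s, ‖C s‖ = ‖s‖) :
    ∃ A : rangeClosure Y →L[ℂ] rangeClosure Y,
      ∀ x, A (sqrtRange hY x) = sqrtRange hY (adjoint V x) := by
  refine ⟨adjoint C ∘L adjoint W ∘L C, fun x => ?_⟩
  rw [ContinuousLinearMap.comp_apply, ContinuousLinearMap.comp_apply, hCR,
    comp_eq_comp_iff_adjoint.mp hmul, ← hCR, adjoint_apply_apply_of_isometry hC]

theorem intertwine_of_sqrtRange {A : rangeClosure Y →L[ℂ] rangeClosure Y}
    (hA : ∀ x, A (sqrtRange hY x) = sqrtRange hY (adjoint V x)) (s : rangeClosure Y) :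
    C (A s) = adjoint W (C s) := by
  refine congrFun ((denseRange_sqrtRange hY).equalizer (C.continuous.comp A.continuous)
    ((adjoint W).continuous.comp C.continuous) (funext fun x => ?_)) s
  simp only [Function.comp_apply]
  rw [hA, hCR, hCR, comp_eq_comp_iff_adjoint.mp hmul]

end Intertwine

section SqrtComp

variable {J : rangeClosure Y →L[ℂ] G}

theorem adjoint_opSqrt_comp_adjoint :
    adjoint (opSqrt Y ∘L (rangeClosure Y).subtypeL ∘L adjoint J) = J ∘L sqrtRange hY := by
  rw [← ContinuousLinearMap.comp_assoc, ← adjoint_sqrtRange hY, ← ContinuousLinearMap.adjoint_comp,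
    ContinuousLinearMap.adjoint_adjoint]

include hY in
theorem opSqrt_comp_adjoint_comp_adjoint_self (hJ : ∀ s, ‖J s‖ = ‖s‖) :
    (opSqrt Y ∘L (rangeClosure Y).subtypeL ∘L adjoint J) ∘L
      adjoint (opSqrt Y ∘L (rangeClosure Y).subtypeL ∘L adjoint J) = Y := by
  ext1 x
  simp only [adjoint_opSqrt_comp_adjoint hY, ContinuousLinearMap.comp_apply,
    adjoint_apply_apply_of_isometry hJ]
  exact opSqrt_opSqrt_apply hY x

theorem opSqrt_comp_adjoint_intertwine {A : rangeClosure Y →L[ℂ] rangeClosure Y} {V : F →L[ℂ] F}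
    {W : G →L[ℂ] G} (hA : ∀ x, A (sqrtRange hY x) = sqrtRange hY (adjoint V x))
    (hJ : ∀ s, J (A s) = adjoint W (J s)) :
    (opSqrt Y ∘L (rangeClosure Y).subtypeL ∘L adjoint J) ∘L W =
      V ∘L opSqrt Y ∘L (rangeClosure Y).subtypeL ∘L adjoint J := by
  refine comp_eq_comp_iff_adjoint.mpr fun x => ?_
  rw [adjoint_opSqrt_comp_adjoint hY, ContinuousLinearMap.comp_apply, ← hJ, hA,
    ContinuousLinearMap.comp_apply]

end SqrtComp

end SqrtRange

/-! ### Characteristic functions -/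

section CharFun

universe u

-- The value used throughout Mathlib; under the default one, the instances needed for adjoints of
-- operators on `Fock n D` with nested defect spaces `D` are not found.
set_option maxSynthPendingDepth 3

variable {k : ℕ} {n : Fin k → ℕ}
variable {H : Type u} [NormedAddCommGroup H] [InnerProductSpace ℂ H] [CompleteSpace H]
variable {f : ∀ i, PosRegular (n i)} {m : Fin k → ℕ} {T : OpTuple n H}
  (hm : ∀ i, 1 ≤ m i) (hT : HasCharFun f m T)

include hT in
theorem kernelDefect_nonneg : 0 ≤ kernelDefect f m T := by
  obtain ⟨-, E, _, _, _, Ψ, -, hΨ⟩ := hT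
  have hfactor : kernelDefect f m T = Ψ ∘L adjoint Ψ := sub_eq_of_eq_add' hΨ.symm
  rw [hfactor, ContinuousLinearMap.nonneg_iff_isPositive]
  exact ContinuousLinearMap.isPositive_self_comp_adjoint Ψ

theorem isCompanionAdjoint_iff_sqrtRange {i : Fin k} {j : Fin (n i)}
    {A : kernelDefectSpace f m T →L[ℂ] kernelDefectSpace f m T} :
    IsCompanionAdjoint f m T i j A ↔
      ∀ x, A (sqrtRange (kernelDefect_nonneg hT) x) = sqrtRange (kernelDefect_nonneg hT)
        (adjoint (universal (defectSpace f m T) f m i j) x) := by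
  refine ⟨fun hA x => Subtype.ext (hA x (sqrtRange (kernelDefect_nonneg hT) x) rfl),
    fun hA x y hy => ?_⟩
  obtain rfl : y = sqrtRange (kernelDefect_nonneg hT) x := Subtype.ext hy
  exact congrArg Subtype.val (hA x)

include hT

theorem isCompanionAdjoint_companionAdjoint (i : Fin k) (j : Fin (n i)) :
    IsCompanionAdjoint f m T i j (companionAdjoint f m T i j) := by
  have hex : ∃ A, IsCompanionAdjoint f m T i j A := by
    obtain ⟨-, E, _, _, _, Ψ, hmul, hΨ⟩ := id hT
    obtain ⟨C, hC, hCR⟩ := exists_isometry_of_factorization (kernelDefect_nonneg hT)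
      (Ψ := Ψ) (sub_eq_of_eq_add' hΨ.symm)
    exact (exists_compression _ hCR (hmul i j) hC).imp fun _ =>
      (isCompanionAdjoint_iff_sqrtRange hT).mpr
  rw [companionAdjoint, dif_pos hex]
  exact hex.choose_spec

theorem adjoint_companion_sqrtRange (i : Fin k) (j : Fin (n i))
    (x : Fock n (defectSpace f m T)) :
    adjoint (companion f m T i j) (sqrtRange (kernelDefect_nonneg hT) x) =
      sqrtRange (kernelDefect_nonneg hT)
        (adjoint (universal (defectSpace f m T) f m i j) x) := by
  have hadj : adjoint (companion f m T i j) = companionAdjoint f m T i j :=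
    ContinuousLinearMap.adjoint_adjoint _
  exact (DFunLike.congr_fun hadj _).trans ((isCompanionAdjoint_iff_sqrtRange hT).mp
    (isCompanionAdjoint_companionAdjoint hT i j) x)

theorem exists_companion_dilation :
    ∃ (E : Type u) (_ : NormedAddCommGroup E) (_ : InnerProductSpace ℂ E) (_ : CompleteSpace E)
      (C : kernelDefectSpace f m T →L[ℂ] Fock n E), (∀ s, ‖C s‖ = ‖s‖) ∧
      ∀ i j s, C (adjoint (companion f m T i j) s) = adjoint (universal E f m i j) (C s) := by
  obtain ⟨-, E, instNormed, instInner, instComplete, Ψ, hmul, hΨ⟩ := id hT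
  obtain ⟨C, hC, hCR⟩ := exists_isometry_of_factorization (kernelDefect_nonneg hT)
    (Ψ := Ψ) (sub_eq_of_eq_add' hΨ.symm)
  exact ⟨E, instNormed, instInner, instComplete, C, hC, fun i j =>
    intertwine_of_sqrtRange _ hCR (hmul i j) (adjoint_companion_sqrtRange hT i j)⟩

theorem companion_commute (p q : Fin k) (hpq : p ≠ q) (a : Fin (n p)) (b : Fin (n q)) :
    Commute (companion f m T p a) (companion f m T q b) := by
  obtain ⟨E, _, _, _, C, hC, hCA⟩ := exists_companion_dilation hT
  exact commute_compression hCA (AddMonoidHomClass.isometry_of_norm C hC).injective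
    (universal_commute hpq a b)

include hm

theorem isBerezinKernel_companion :
    IsBerezinKernel f m (companion f m T) (berezinKernel f m (companion f m T)) := by
  obtain ⟨E, _, _, _, C, hC, hCA⟩ := exists_companion_dilation hT
  exact isBerezinKernel_of_universal_compression hm hCA hC

theorem norm_berezinKernel_companion (s : kernelDefectSpace f m T) :
    ‖berezinKernel f m (companion f m T) s‖ = ‖s‖ := by
  obtain ⟨E, _, _, _, C, hC, hCA⟩ := exists_companion_dilation hT
  exact norm_berezinKernel_of_universal_compression hm hCA hC s

theorem berezinKernel_comp_adjoint_add_charFun_comp_adjoint :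
    berezinKernel f m T ∘L adjoint (berezinKernel f m T) +
      charFun f m T ∘L adjoint (charFun f m T) = 1 :=
  add_eq_of_eq_sub' (opSqrt_comp_adjoint_comp_adjoint_self (kernelDefect_nonneg hT)
    (norm_berezinKernel_companion hm hT))

theorem isMultiAnalytic_charFun : IsMultiAnalytic f m (charFun f m T) := fun i j =>
  opSqrt_comp_adjoint_intertwine (kernelDefect_nonneg hT) (adjoint_companion_sqrtRange hT i j)
    ((isBerezinKernel_companion hm hT).intertwine (companion_commute hT) i j)

theorem isInner_charFun_iff :
    IsInner f m (charFun f m T) ↔ IsPartialIsometry (berezinKernel f m T) :=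
  (and_iff_right (isMultiAnalytic_charFun hm hT)).trans
    (isPartialIsometry_iff_of_comp_adjoint_add_eq_one (K := berezinKernel f m T)
      (Θ := charFun f m T) (berezinKernel_comp_adjoint_add_charFun_comp_adjoint hm hT)).symm

theorem unitarilyEquivalent_modelTuple (hK : ∀ h, ‖berezinKernel f m T h‖ = ‖h‖) :
    UnitarilyEquivalent T (modelTuple f m T) := by
  obtain ⟨U, hU⟩ : ∃ U : H ≃ₗᵢ[ℂ] modelSpace f m T,
      ∀ y, (U y : Fock n (defectSpace f m T)) = berezinKernel f m T y :=
    exists_unitary_of_isometry (berezinKernel_comp_adjoint_add_charFun_comp_adjoint hm hT) hK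
  exact ⟨U, fun i j => eq_symm_compression U hU
    ((hT.1.isBerezinKernel hm).intertwine hT.1.commute i j)⟩

end CharFun

end Polydomain

theorem mainTheorem11 {k : ℕ} {n m : Fin k → ℕ} (hn : ∀ i, 1 ≤ n i) (hm : ∀ i, 1 ≤ m i)
    (f : ∀ i, PosRegular (n i))
    {H : Type*} [NormedAddCommGroup H] [InnerProductSpace ℂ H] [CompleteSpace H]
    (T : OpTuple n H) (hT : HasCharFun f m T) :
    -- the operators that define the characteristic function exist
    (IsBerezinKernel f m T (berezinKernel f m T) ∧
      (∀ i j, IsCompanionAdjoint f m T i j (companionAdjoint f m T i j)) ∧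
      IsBerezinKernel f m (companion f m T) (berezinKernel f m (companion f m T))) ∧
    -- the characterization of purity
    (IsCNC f T → (IsPure f T ↔ IsInner f m (charFun f m T))) ∧
    -- in the pure case, the characteristic function is inner and gives a model
    (IsPure f T →
      IsInner f m (charFun f m T) ∧ UnitarilyEquivalent T (modelTuple f m T)) := by
  have hpure : IsPure f T ↔ ∀ h, ‖berezinKernel f m T h‖ = ‖h‖ := hT.1.isPure_iff hm
  have hinner := isInner_charFun_iff hm hT
  have hinner_of_pure : IsPure f T → IsInner f m (charFun f m T) := fun h =>
    hinner.mpr fun x _ => hpure.mp h x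
  refine ⟨⟨hT.1.isBerezinKernel hm, isCompanionAdjoint_companionAdjoint hT,
    isBerezinKernel_companion hm hT⟩, fun hcnc => ⟨hinner_of_pure, fun h => hpure.mpr ?_⟩,
    fun h => ⟨hinner_of_pure h, unitarilyEquivalent_modelTuple hm hT (hpure.mp h)⟩⟩
  exact norm_eq_of_isPartialIsometry_of_injective (hinner.mp h)
    (hT.1.injective_berezinKernel hm hcnc)
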